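/- Let $\mathcal{M}$ be a commutative von Neumann algebra acting on a Hilbert space, let $\mathcal{D}$ be a von Neumann subalgebra of $\mathcal{M}$ containing the unit of $\mathcal{M}$, and let $\mathcal{A}$ be a weak* closed subalgebra of $\mathcal{M}$ with $\mathcal{D} \subset \mathcal{A} \subset \mathcal{M}$. Let $\sigma$ be a faithful normal semifinite weight on $\mathcal{D}$, and let $\Phi : \mathcal{A} \to \mathcal{D}$ be a weak* continuous $\mathcal{D}$-character, that is, a weak* continuous unital contractive homomorphism which is the identity map on $\mathcal{D}$. Conventions. A weight on a von Neumann algebra $\mathcal{N}$ is an additive, positively homogeneous map $\omega : \mathcal{N}_+ \to [0,\infty]$; it is normal if it preserves suprema of bounded increasing nets in $\mathcal{N}_+$, semifinite if $\{x \in \mathcal{N} : \omega(x^*x) < \infty\}$ is weak* dense in $\mathcal{N}$, and a trace if $\omega(x^*x) = \omega(xx^*)$ for all $x \in \mathcal{N}$. We also write $\omega$ for its linear extension to the linear span $\mathfrak{m}_\omega$ of $\{x \in \mathcal{N}_+ : \omega(x) < \infty\}$. A weight $\rho$ on $\mathcal{M}$ extends $\sigma \circ \Phi$ if $\rho(a)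 = \sigma(\Phi(a))$ for every $a \in \mathcal{A}$ at which both sides are defined, i.e. in $[0,\infty]$ if $a \geq 0$ and $\Phi(a) \geq 0$, and in $\mathbb{C}$ if $a \in \mathfrak{m}_\rho$ and $\Phi(a) \in \mathfrak{m}_\sigma$. A normal conditional expectation $\Psi : \mathcal{M} \to \mathcal{D}$ is a weak* continuous unital positive idempotent $\mathcal{D}$-bimodule map of $\mathcal{M}$ onto $\mathcal{D}$; it is $\rho$-preserving if $\rho(\Psi(x)) = \rho(x)$ for all $x \in \mathcal{M}_+$. Then: 1. $\sigma \circ \Phi$ extends to a normal semifinite weight $\rho$ on $\mathcal{M}$ such that there is a unique $\rho$-preserving normal conditional expectation $\mathcal{M} \to \mathcal{D}$, and this expectation extends $\Phi$. 2. Indeed, for any normal semifinite trace $\rho$ on $\mathcal{M}$ extending $\sigma \circ \Phi$, there is a unique $\rho$-preserving normal conditional expectation $\mathcal{M} \to \mathcal{D}$, and this expectation extends $\Phi$. -/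

import Mathlib

open scoped ENNReal NNReal InnerProductSpace Topology

noncomputable section

namespace HoffmanRossi

variable {H : Type*} [NormedAddCommGroup H] [InnerProductSpace ℂ H] [CompleteSpace H]

/-- The weak* (that is, σ-weak) topology of `B(H)`: the coarsest topology for which all the
functionals `x ↦ ∑ₙ ⟪ξₙ, x ηₙ⟫` with `∑ ‖ξₙ‖² < ∞` and `∑ ‖ηₙ‖² < ∞` are continuous.
The weak* topology of a von Neumann algebra on `H` is the subspace topology. -/
@[reducible] def weakStarTopology (H : Type*) [NormedAddCommGroup H] [InnerProductSpace ℂ H] :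
    TopologicalSpace (H →L[ℂ] H) :=
  ⨅ (ξ : lp (fun _ : ℕ => H) 2) (η : lp (fun _ : ℕ => H) 2),
    TopologicalSpace.induced (fun x : H →L[ℂ] H => ∑' n, ⟪ξ n, x (η n)⟫_ℂ) inferInstance

/-- The weak* topology on a set of operators. -/
@[reducible] def weakStarTopologyOn (S : Set (H →L[ℂ] H)) : TopologicalSpace S :=
  TopologicalSpace.induced Subtype.val (weakStarTopology H)

/-- The positive cone `N₊` of a von Neumann algebra `N`. -/
def posCone (N : VonNeumannAlgebra H) : Set (H →L[ℂ] H) := {x | x ∈ N ∧ 0 ≤ x}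

/-- A weight on the von Neumann algebra `N`: an additive and positively homogeneous map
`N₊ → [0, ∞]`. -/
structure Weight (N : VonNeumannAlgebra H) where
  /-- the underlying map -/
  toFun : posCone N → ℝ≥0∞
  map_add : ∀ x y z : posCone N,
    (z : H →L[ℂ] H) = (x : H →L[ℂ] H) + (y : H →L[ℂ] H) → toFun z = toFun x + toFun y
  map_smul : ∀ (t : ℝ≥0) (x z : posCone N),
    (z : H →L[ℂ] H) = ((t : ℝ) : ℂ) • (x : H →L[ℂ] H) → toFun z = (t : ℝ≥0∞) * toFun x

namespace Weight

variable {M N D : VonNeumannAlgebra H}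

instance : CoeFun (Weight N) (fun _ => posCone N → ℝ≥0∞) := ⟨Weight.toFun⟩

/-- `ω` is faithful: it vanishes at no nonzero positive element. -/
def IsFaithful (ω : Weight N) : Prop :=
  ∀ x : posCone N, ω x = 0 → (x : H →L[ℂ] H) = 0

/-- `ω` is normal: it preserves suprema of (bounded) increasing nets in `N₊`. -/
def IsNormal (ω : Weight N) : Prop :=
  ∀ (S : Set (posCone N)) (x : posCone N), S.Nonempty → DirectedOn (· ≤ ·) S → IsLUB S x →
    ω x = ⨆ s ∈ S, ω s

/-- The set of all `y ∈ N` with `ω (y* y) < ∞`. -/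
def squareFinite (ω : Weight N) : Set (H →L[ℂ] H) :=
  {y | y ∈ N ∧ ∃ p : posCone N, (p : H →L[ℂ] H) = star y * y ∧ ω p < ∞}

/-- `ω` is semifinite: the set of all `y ∈ N` with `ω (y* y) < ∞` is weak* dense in `N`. -/
def IsSemifinite (ω : Weight N) : Prop :=
  (N : Set (H →L[ℂ] H)) ⊆ @closure _ (weakStarTopology H) ω.squareFinite

/-- `ω` is a trace: `ω (y* y) = ω (y y*)` for all `y ∈ N`. -/
def IsTracial (ω : Weight N) : Prop :=
  ∀ y ∈ N, ∀ p q : posCone N,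
    (p : H →L[ℂ] H) = star y * y → (q : H →L[ℂ] H) = y * star y → ω p = ω q

/-- The canonical linear extension of the weight `ω` to the span of the `x ∈ N₊` with
`ω x < ∞`, as a relation: `ω.HasValue x z` says that `x` lies in this span and that the value
there is `z`, that is, `x = p₀ + i p₁ - p₂ - i p₃` and
`z = ω p₀ + i ω p₁ - ω p₂ - i ω p₃` with all `pₖ ∈ N₊` and all `ω pₖ` finite. -/
def HasValue (ω : Weight N) (x : H →L[ℂ] H) (z : ℂ) : Prop :=
  ∃ p : Fin 4 → posCone N, (∀ k, ω (p k) ≠ ∞) ∧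
    x = ∑ k : Fin 4, Complex.I ^ (k : ℕ) • (p k : H →L[ℂ] H) ∧
    z = ∑ k : Fin 4, Complex.I ^ (k : ℕ) * ((ω (p k)).toReal : ℂ)

/-- The value in `HasValue` is well defined. -/
theorem HasValue.unique (ω : Weight N) (x : H →L[ℂ] H) (z w : ℂ)
   (hz : ω.HasValue x z) (hw : ω.HasValue x w) : z = w := by
  obtain ⟨p, hp, hx, rfl⟩ := hz
  obtain ⟨q, hq, hx', rfl⟩ := hw
  have key : ∀ a b c d : posCone N, ω a ≠ ∞ → ω b ≠ ∞ → ω c ≠ ∞ → ω d ≠ ∞ →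
     (a : H →L[ℂ] H) - b = c - d → (ω a).toReal - (ω b).toReal = (ω c).toReal - (ω d).toReal := by
    intro a b c d ha hb hc hd h
    have hs : (a : H →L[ℂ] H) + d = c + b := by
      have := congrArg (fun t => t + (b : H →L[ℂ] H) + d) h
      beta_reduce at this
      rw [sub_add_cancel] at this
      rw [this]; abel
    let e : posCone N := ⟨(a : H →L[ℂ] H) + d, add_mem a.2.1 d.2.1, add_nonneg a.2.2 d.2.2⟩
    have h1 := ω.map_add a d e rfl
    have h2 := ω.map_add c b e hs
    have h3 := congrArg ENNReal.toReal (h1.symm.trans h2)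
    rw [ENNReal.toReal_add ha hd, ENNReal.toReal_add hc hb] at h3
    linarith
  have sa : ∀ r : posCone N, star (r : H →L[ℂ] H) = r := fun r =>
    (IsSelfAdjoint.of_nonneg r.2.2).star_eq
  rw [hx] at hx'
  simp only [Fin.sum_univ_four, Fin.val_zero, Fin.val_one, Fin.val_two, pow_zero, pow_one, one_smul, Complex.I_sq, neg_smul, one_mul, neg_mul, show ((3 : Fin 4) : ℕ) = 3 from rfl, Complex.I_pow_three] at hx' ⊢
  have hst := congrArg star hx'
  simp only [star_add, star_neg, star_smul, sa, Complex.star_def, Complex.conj_I, neg_smul, neg_neg] at hst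
  have e1 : ((p 0 : H →L[ℂ] H) - p 2) = q 0 - q 2 := by
    have : (2:ℂ) • ((p 0 : H →L[ℂ] H) - p 2) = (2:ℂ) • ((q 0 : H →L[ℂ] H) - q 2) := by
      have := congrArg₂ (· + ·) hx' hst
      beta_reduce at this
      rw [two_smul, two_smul]
      convert this using 1 <;> abel
    exact smul_right_injective _ (two_ne_zero) this
  have e2 : ((p 1 : H →L[ℂ] H) - p 3) = q 1 - q 3 := by
    have : (2*Complex.I:ℂ) • ((p 1 : H →L[ℂ] H) - p 3) = (2*Complex.I:ℂ) • ((q 1 : H →L[ℂ] H) - q 3) := by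
      have := congrArg₂ (· - ·) hx' hst
      beta_reduce at this
      rw [mul_smul, mul_smul, two_smul, two_smul, smul_sub, smul_sub]
      convert this using 1 <;> abel
    exact smul_right_injective _ (mul_ne_zero two_ne_zero Complex.I_ne_zero) this
  have k1 := key _ _ _ _ (hp 0) (hp 2) (hq 0) (hq 2) e1
  have k2 := key _ _ _ _ (hp 1) (hp 3) (hq 1) (hq 3) e2
  apply Complex.ext <;> simp <;> linarith

/-- The weight `ρ` on `M` extends `σ ∘ Φ`, where `Φ : A → D`: the two agree at all elements of
`A` at which both are defined, be it as elements of `[0, ∞]` (at `a ≥ 0` with `Φ a ≥ 0`) or as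
complex numbers, through the linear extensions of the weights to their definition domains. -/
structure ExtendsComp {A : Set (H →L[ℂ] H)} (ρ : Weight M) (σ : Weight D)
    (Φ : A → (D : Set (H →L[ℂ] H))) : Prop where
  of_nonneg : ∀ (a : A) (x : posCone M) (y : posCone D),
    (x : H →L[ℂ] H) = (a : H →L[ℂ] H) → (y : H →L[ℂ] H) = (Φ a : H →L[ℂ] H) → ρ x = σ y
  of_hasValue : ∀ (a : A) (z w : ℂ),
    ρ.HasValue (a : H →L[ℂ] H) z → σ.HasValue (Φ a : H →L[ℂ] H) w → z = w

end Weight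

/-- `Φ : A → D` is a `D`-character: a unital contractive homomorphism that is the identity
on `D`. (Unital, multiplicative and linear are part of `→ₐ[ℂ]`.) -/
structure IsDCharacter {D : VonNeumannAlgebra H} {A : Subalgebra ℂ (H →L[ℂ] H)}
    (Φ : A →ₐ[ℂ] D.toStarSubalgebra) : Prop where
  contractive : ∀ a : A, ‖(Φ a : H →L[ℂ] H)‖ ≤ ‖(a : H →L[ℂ] H)‖
  map_of_mem : ∀ a : A, (a : H →L[ℂ] H) ∈ D → (Φ a : H →L[ℂ] H) = a

/-- `Ψ : M → D` is a normal conditional expectation: a unital positive idempotent `D`-bimodule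
map of `M` onto `D` that is weak* continuous. -/
structure IsNormalCondExp {M D : VonNeumannAlgebra H}
    (Ψ : M.toStarSubalgebra →ₗ[ℂ] D.toStarSubalgebra) : Prop where
  map_one : Ψ 1 = 1
  nonneg : ∀ x : M.toStarSubalgebra,
    0 ≤ (x : H →L[ℂ] H) → 0 ≤ (Ψ x : H →L[ℂ] H)
  map_of_mem : ∀ x : M.toStarSubalgebra, (x : H →L[ℂ] H) ∈ D → (Ψ x : H →L[ℂ] H) = x
  map_bimodule : ∀ (d e : D.toStarSubalgebra) (x y : M.toStarSubalgebra),
    (y : H →L[ℂ] H) = (d : H →L[ℂ] H) * x * e →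
      (Ψ y : H →L[ℂ] H) = (d : H →L[ℂ] H) * Ψ x * e
  continuous : Continuous[weakStarTopologyOn (M : Set (H →L[ℂ] H)),
    weakStarTopologyOn (D : Set (H →L[ℂ] H))] Ψ

/-- `Ψ : M → D` preserves the weight `ρ` on `M`: `ρ (Ψ x) = ρ x` for all `x ∈ M₊`. -/
def Preserves {M D : VonNeumannAlgebra H}
    (Ψ : M.toStarSubalgebra →ₗ[ℂ] D.toStarSubalgebra) (ρ : Weight M) : Prop :=
  ∀ x y : posCone M, (y : H →L[ℂ] H) = (Ψ ⟨x, x.2.1⟩ : H →L[ℂ] H) → ρ y = ρ x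

/-- `Ψ : M → D` extends `Φ : A → D`, where `A ⊆ M`. -/
def Extends {M D : VonNeumannAlgebra H} {A : Subalgebra ℂ (H →L[ℂ] H)}
    (Ψ : M.toStarSubalgebra →ₗ[ℂ] D.toStarSubalgebra) (Φ : A →ₐ[ℂ] D.toStarSubalgebra) : Prop :=
  ∀ (a : A) (x : M.toStarSubalgebra), (x : H →L[ℂ] H) = (a : H →L[ℂ] H) → Ψ x = Φ a

/-- There is exactly one normal conditional expectation `M → D` that preserves `ρ`, and it
extends `Φ`. -/
def ExistsUniqueExtension {M D : VonNeumannAlgebra H} {A : Subalgebra ℂ (H →L[ℂ] H)}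
    (ρ : Weight M) (Φ : A →ₐ[ℂ] D.toStarSubalgebra) : Prop :=
  ∃ Ψ : M.toStarSubalgebra →ₗ[ℂ] D.toStarSubalgebra,
    (IsNormalCondExp Ψ ∧ Preserves Ψ ρ ∧ Extends Ψ Φ) ∧
    ∀ Ψ' : M.toStarSubalgebra →ₗ[ℂ] D.toStarSubalgebra,
      IsNormalCondExp Ψ' → Preserves Ψ' ρ → Ψ' = Ψ

end HoffmanRossi

end

/-! Everything is read off from the functionals `ρ (d ·)` on `M`, with `d ∈ D` positive of finite
weight. As `M` is commutative, these are finite normal weights, and `exists_eq_tsum_vecWeight`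
writes each of them as `x ↦ ∑ₙ ⟪ζₙ, x ζₙ⟫`, which is linear and weak* continuous.

The expectation. Let `ρ` be normal on `M` with restriction `σ` to `D`. For `0 ≤ x ≤ 1` in `M` the
weight `d ↦ ρ (d x)` on `D` is dominated by `ρ`, so Radon–Nikodym (`exists_density`) gives `E x ∈ D`
with `ρ (d E x) = ρ (d x)` whenever `ρ d < ∞`. Since `σ` is faithful and semifinite, the functionals
`ρ (d ·)` separate `D` (`eq_zero_of_represents`), so this identity determines `E x`, and the
properties of a conditional expectation follow (`exists_isNormalCondExp`). Every `ρ`-preserving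
expectation satisfies the identity, hence equals `E`; and `E` extends `Φ` as soon as `ρ (d a) = ρ (d
Φ(a))` on `A`. If `ρ` extends `σ ∘ Φ`, the latter is the extension property at `d a`, which is the
second claim.

Existence of `ρ`. Take a maximal normal weight `ρ` on `M` with `ρ ≤ σ` on `D` and all `ρ (d ·)` zero
on `ker Φ`. Suppose `ρ d < σ d`. The functional `σ (d Φ(·))` on `A` is weak* continuous, hence of
the form `a ↦ ⟪ξ, a η⟫` in `ℓ²(ℕ, H)`. Let `ζ` be the component of `η` orthogonal to `V`, the
closure of `(ker Φ) η`. As `ker Φ` is an ideal, `V` is `A`-invariant, and so `⟪ζ, a ζ⟫ = 0` for `a ∈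
ker Φ`; as `ξ ⊥ V`, positive elements of `D` killing `ζ` are null for `σ (d ·)`
(`exists_vanishing_vector`). A small piece of `⟪ζ, · ζ⟫`, cut down by a Hahn decomposition, can then
be added to `ρ`, against maximality (`exists_larger`). -/

set_option linter.unusedSectionVars false

noncomputable section

namespace HoffmanRossi

variable {H : Type*} [NormedAddCommGroup H] [InnerProductSpace ℂ H] [CompleteSpace H]

/-! ### Operator order, suprema and commutative von Neumann algebras. -/

section

/-- The quadratic form of an operator. -/
def quad (x : H →L[ℂ] H) (ξ : H) : ℝ := (⟪ξ, x ξ⟫_ℂ).re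

theorem quad_add (x y : H →L[ℂ] H) (ξ : H) : quad (x + y) ξ = quad x ξ + quad y ξ := by
  simp [quad]

theorem quad_sub (x y : H →L[ℂ] H) (ξ : H) : quad (x - y) ξ = quad x ξ - quad y ξ := by
  simp [quad]

theorem quad_real_smul (t : ℝ) (x : H →L[ℂ] H) (ξ : H) :
    quad ((t : ℂ) • x) ξ = t * quad x ξ := by
  simp [quad]

theorem quad_vec_smul (t : ℝ) (x : H →L[ℂ] H) (ξ : H) :
    quad x ((t : ℂ) • ξ) = t ^ 2 * quad x ξ := by
  simp [quad]; ring

theorem quad_nonneg {x : H →L[ℂ] H} (hx : 0 ≤ x) (ξ : H) : 0 ≤ quad x ξ := by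
  have h := ((ContinuousLinearMap.nonneg_iff_isPositive x).1 hx).re_inner_nonneg_right ξ
  exact h

theorem inner_eq_quad {x : H →L[ℂ] H} (hx : 0 ≤ x) (ξ : H) : ⟪ξ, x ξ⟫_ℂ = (quad x ξ : ℂ) := by
  have h := ((ContinuousLinearMap.nonneg_iff_isPositive x).1 hx).inner_nonneg_right ξ
  rw [Complex.le_def] at h
  apply Complex.ext
  · simp [quad]
  · simpa using h.2.symm

theorem nonneg_of_quad {x : H →L[ℂ] H} (hx : IsSelfAdjoint x) (h : ∀ ξ, 0 ≤ quad x ξ) : 0 ≤ x := by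
  rw [ContinuousLinearMap.nonneg_iff_isPositive, ContinuousLinearMap.isPositive_def']
  refine ⟨hx, fun ξ => ?_⟩
  have := h ξ
  rw [ContinuousLinearMap.reApplyInnerSelf_apply, inner_re_symm]
  exact this

theorem quad_mono {x y : H →L[ℂ] H} (h : x ≤ y) (ξ : H) : quad x ξ ≤ quad y ξ := by
  have := quad_nonneg (sub_nonneg.2 h) ξ
  rw [quad_sub] at this
  linarith

theorem le_of_quad {x y : H →L[ℂ] H} (hx : IsSelfAdjoint x) (hy : IsSelfAdjoint y)
    (h : ∀ ξ, quad x ξ ≤ quad y ξ) : x ≤ y := by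
  rw [← sub_nonneg]
  refine nonneg_of_quad (hy.sub hx) fun ξ => ?_
  rw [quad_sub]
  linarith [h ξ]

theorem quad_mul_self {x : H →L[ℂ] H} (hx : IsSelfAdjoint x) (ξ : H) :
    quad (x * x) ξ = ‖x ξ‖ ^ 2 := by
  have h : ⟪ξ, x (x ξ)⟫_ℂ = ⟪x ξ, x ξ⟫_ℂ := by
    rw [← ContinuousLinearMap.adjoint_inner_left, ← ContinuousLinearMap.star_eq_adjoint, hx.star_eq]
  rw [quad, mul_apply_eq_comp, h, inner_self_eq_norm_sq_to_K]
  norm_cast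

theorem quad_conj {r : H →L[ℂ] H} (hr : IsSelfAdjoint r) (x : H →L[ℂ] H) (ξ : H) :
    quad (r * x * r) ξ = quad x (r ξ) := by
  simp only [quad, mul_apply_eq_comp]
  rw [← ContinuousLinearMap.adjoint_inner_left, ← ContinuousLinearMap.star_eq_adjoint, hr.star_eq]

theorem quad_le_norm (x : H →L[ℂ] H) (ξ : H) : quad x ξ ≤ ‖x‖ * ‖ξ‖ ^ 2 := by
  calc quad x ξ ≤ ‖⟪ξ, x ξ⟫_ℂ‖ := Complex.re_le_norm _
    _ ≤ ‖ξ‖ * ‖x ξ‖ := norm_inner_le_norm _ _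
    _ ≤ ‖ξ‖ * (‖x‖ * ‖ξ‖) := by gcongr; exact x.le_opNorm ξ
    _ = _ := by ring

/-- The square root of a positive operator, with its formal properties. -/
theorem exists_sqrt {x : H →L[ℂ] H} (hx : 0 ≤ x) :
    ∃ r : H →L[ℂ] H, 0 ≤ r ∧ r * r = x ∧ ∀ y, Commute x y → Commute r y :=
  ⟨CFC.sqrt x, CFC.sqrt_nonneg x, CFC.sqrt_mul_sqrt_self x hx, fun y h => by
    rw [CFC.sqrt_eq_cfc]
    exact h.cfc_nnreal _⟩

/-- Cauchy–Schwarz for the form of `a`: with `r = √a`, `‖a ξ‖² = ⟪r ξ, a (r ξ)⟫ ≤ ‖a‖ ‖r ξ‖²`. It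
turns convergence of quadratic forms of a monotone net into strong convergence. -/
theorem norm_apply_sq_le {a b : H →L[ℂ] H} (ha : 0 ≤ a) (hab : a ≤ b) (ξ : H) :
    ‖a ξ‖ ^ 2 ≤ ‖b‖ * quad a ξ := by
  obtain ⟨r, hr, hra, -⟩ := exists_sqrt ha
  have hs := IsSelfAdjoint.of_nonneg hr
  have h1 : quad a ξ = ‖r ξ‖ ^ 2 := by rw [← hra, quad_mul_self hs]
  have h2 : ‖a ξ‖ ^ 2 = quad a (r ξ) := by
    rw [← quad_conj hs, ← quad_mul_self (IsSelfAdjoint.of_nonneg ha), ← hra]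
    simp only [mul_assoc]
  rw [h1, h2]
  have h3 : ‖a‖ ≤ ‖b‖ := CStarAlgebra.norm_le_norm_of_nonneg_of_le ha hab
  calc quad a (r ξ) ≤ ‖a‖ * ‖r ξ‖ ^ 2 := quad_le_norm _ _
    _ ≤ _ := by gcongr

variable {N : VonNeumannAlgebra H}

theorem smul_mem_vN (c : ℂ) {x : H →L[ℂ] H} (hx : x ∈ N) : c • x ∈ N :=
  N.toStarSubalgebra.smul_mem hx c

/-- The bicommutant property; it keeps square roots and strong limits inside `N`. -/
theorem mem_of_commute {x : H →L[ℂ] H} (h : ∀ y, (∀ z ∈ N, z * y = y * z) → y * x = x * y) :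
    x ∈ N := by
  rw [← VonNeumannAlgebra.commutant_commutant N, VonNeumannAlgebra.mem_commutant_iff]
  intro g hg
  rw [VonNeumannAlgebra.mem_commutant_iff] at hg
  exact h g hg

theorem exists_sqrt_mem {x : H →L[ℂ] H} (hx : x ∈ posCone N) :
    ∃ r ∈ posCone N, r * r = x := by
  obtain ⟨r, hr, hrx, hc⟩ := exists_sqrt hx.2
  exact ⟨r, ⟨mem_of_commute fun y hy => (hc y (hy x hx.1)).eq.symm, hr⟩, hrx⟩

theorem posCone.isSelfAdjoint {x : H →L[ℂ] H} (hx : x ∈ posCone N) : IsSelfAdjoint x :=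
  .of_nonneg hx.2

theorem posCone.add_mem {x y : H →L[ℂ] H} (hx : x ∈ posCone N) (hy : y ∈ posCone N) :
    x + y ∈ posCone N := ⟨AddMemClass.add_mem hx.1 hy.1, add_nonneg hx.2 hy.2⟩

theorem posCone.zero_mem : (0 : H →L[ℂ] H) ∈ posCone N := ⟨ZeroMemClass.zero_mem N, le_rfl⟩

theorem posCone.one_mem : (1 : H →L[ℂ] H) ∈ posCone N := ⟨OneMemClass.one_mem N, zero_le_one⟩

theorem real_smul_nonneg {t : ℝ} (ht : 0 ≤ t) {x : H →L[ℂ] H} (hx : 0 ≤ x) :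
    0 ≤ (t : ℂ) • x :=
  open scoped ComplexOrder in
  (ContinuousLinearMap.nonneg_iff_isPositive _).2
    (((ContinuousLinearMap.nonneg_iff_isPositive x).1 hx).smul_of_nonneg
      (Complex.zero_le_real.2 ht))

theorem posCone.smul_mem {t : ℝ} (ht : 0 ≤ t) {x : H →L[ℂ] H} (hx : x ∈ posCone N) :
    (t : ℂ) • x ∈ posCone N :=
  ⟨smul_mem_vN _ hx.1, real_smul_nonneg ht hx.2⟩

theorem posCone.sub_mem {x y : H →L[ℂ] H} (hx : x ∈ posCone N) (hy : y ∈ posCone N)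
    (h : y ≤ x) : x - y ∈ posCone N := ⟨_root_.sub_mem hx.1 hy.1, sub_nonneg.2 h⟩

theorem isLUB_of_quad {S : Set (H →L[ℂ] H)} {x : H →L[ℂ] H} (hS : S.Nonempty)
    (hSs : ∀ s ∈ S, IsSelfAdjoint s) (hx : IsSelfAdjoint x)
    (h : ∀ ξ, IsLUB ((fun s => quad s ξ) '' S) (quad x ξ)) : IsLUB S x := by
  constructor
  · intro s hs
    exact le_of_quad (hSs s hs) hx fun ξ => (h ξ).1 ⟨s, hs, rfl⟩
  · intro u hu
    obtain ⟨s, hs⟩ := hS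
    have hus : IsSelfAdjoint u := by
      have := (IsSelfAdjoint.of_nonneg (sub_nonneg.2 (hu hs))).add (hSs s hs)
      simpa using this
    refine le_of_quad hx hus fun ξ => (h ξ).2 ?_
    rintro _ ⟨t, ht, rfl⟩
    exact quad_mono (hu ht) ξ

/-- Bounded directed sets of positive elements of a von Neumann algebra have suprema in it. -/
theorem exists_isLUB_quad {S : Set (H →L[ℂ] H)} (hSN : S ⊆ posCone N) (hne : S.Nonempty)
    (hd : DirectedOn (· ≤ ·) S) {b : H →L[ℂ] H} (hb : ∀ s ∈ S, s ≤ b) :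
    ∃ x ∈ posCone N, ∀ ξ, IsLUB ((fun s => quad s ξ) '' S) (quad x ξ) := by
  have : Nonempty S := hne.to_subtype
  have : IsDirected S (· ≤ ·) := ⟨fun a c => by
    obtain ⟨z, hz, h1, h2⟩ := hd a a.2 c c.2
    exact ⟨⟨z, hz⟩, h1, h2⟩⟩
  have hmono : ∀ ξ, Monotone fun s : S => quad (s : H →L[ℂ] H) ξ :=
    fun ξ s t hst => quad_mono hst ξ
  have hbdd : ∀ ξ, BddAbove (Set.range fun s : S => quad (s : H →L[ℂ] H) ξ) := by
    intro ξ
    refine ⟨quad b ξ, ?_⟩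
    rintro _ ⟨s, rfl⟩
    exact quad_mono (hb s s.2) ξ
  have key : ∀ ξ, ∃ v, Filter.Tendsto (fun s : S => (s : H →L[ℂ] H) ξ) Filter.atTop (𝓝 v) := by
    intro ξ
    refine cauchy_map_iff_exists_tendsto.1 (Metric.cauchy_iff.2 ⟨inferInstance, fun ε hε => ?_⟩)
    set L := ⨆ s : S, quad (s : H →L[ℂ] H) ξ
    have hδ : 0 < (ε / 2) ^ 2 / (‖b‖ + 1) := by positivity
    obtain ⟨s₀, hs₀⟩ := exists_lt_of_lt_ciSup (sub_lt_self L hδ)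
    have hclose : ∀ s : S, s₀ ≤ s → ‖(s : H →L[ℂ] H) ξ - (s₀ : H →L[ℂ] H) ξ‖ < ε / 2 := by
      intro s hs
      have hs' : (s₀ : H →L[ℂ] H) ≤ s := hs
      have h1 : ‖((s : H →L[ℂ] H) - (s₀ : H →L[ℂ] H)) ξ‖ ^ 2
          ≤ ‖b‖ * quad ((s : H →L[ℂ] H) - (s₀ : H →L[ℂ] H)) ξ :=
        norm_apply_sq_le (sub_nonneg.2 hs')
          ((sub_le_self _ (hSN s₀.2).2).trans (hb s s.2)) ξ
      have h2 : quad (s : H →L[ℂ] H) ξ ≤ L := le_ciSup (hbdd ξ) s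
      rw [quad_sub] at h1
      have h3 : ‖((s : H →L[ℂ] H) - (s₀ : H →L[ℂ] H)) ξ‖ ^ 2 < (ε / 2) ^ 2 := by
        have h4 : quad (s : H →L[ℂ] H) ξ - quad (s₀ : H →L[ℂ] H) ξ
            < (ε / 2) ^ 2 / (‖b‖ + 1) := by linarith
        have h5 : 0 ≤ quad (s : H →L[ℂ] H) ξ - quad (s₀ : H →L[ℂ] H) ξ :=
          sub_nonneg.2 (hmono ξ hs)
        rw [lt_div_iff₀ (by positivity)] at h4
        nlinarith
      exact lt_of_pow_lt_pow_left₀ 2 (by positivity) h3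
    refine ⟨_, Filter.image_mem_map (Filter.mem_atTop s₀), ?_⟩
    rintro _ ⟨s, hs, rfl⟩ _ ⟨t, ht, rfl⟩
    calc dist ((s : H →L[ℂ] H) ξ) ((t : H →L[ℂ] H) ξ)
        ≤ dist ((s : H →L[ℂ] H) ξ) ((s₀ : H →L[ℂ] H) ξ)
          + dist ((t : H →L[ℂ] H) ξ) ((s₀ : H →L[ℂ] H) ξ) := dist_triangle_right _ _ _
      _ < ε := by
        rw [dist_eq_norm, dist_eq_norm]
        linarith [hclose s hs, hclose t ht]
  choose f hf using key
  have hbd : Bornology.IsBounded (Set.range fun s : S => (s : H →L[ℂ] H)) := by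
    rw [isBounded_iff_forall_norm_le]
    refine ⟨‖b‖, ?_⟩
    rintro _ ⟨s, rfl⟩
    exact CStarAlgebra.norm_le_norm_of_nonneg_of_le (hSN s.2).2 (hb s s.2)
  let x : H →L[ℂ] H := ContinuousLinearMap.ofTendstoOfBoundedRange f
    (fun s : S => (s : H →L[ℂ] H)) (tendsto_pi_nhds.2 hf) hbd
  have hx : ∀ ξ, Filter.Tendsto (fun s : S => (s : H →L[ℂ] H) ξ) Filter.atTop (𝓝 (x ξ)) := hf
  have hq : ∀ ξ, Filter.Tendsto (fun s : S => quad (s : H →L[ℂ] H) ξ) Filter.atTop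
      (𝓝 (quad x ξ)) := fun ξ =>
    (Complex.continuous_re.tendsto _).comp (tendsto_const_nhds.inner (hx ξ))
  have hlub : ∀ ξ, IsLUB ((fun s => quad s ξ) '' S) (quad x ξ) := by
    intro ξ
    have := isLUB_of_tendsto_atTop (hmono ξ) (hq ξ)
    rwa [Set.image_eq_range]
  have hsa : IsSelfAdjoint x := by
    rw [ContinuousLinearMap.isSelfAdjoint_iff_isSymmetric]
    intro ξ η
    have h1 := (hx ξ).inner (𝕜 := ℂ) (tendsto_const_nhds (x := η))
    have h2 := (tendsto_const_nhds (x := ξ)).inner (𝕜 := ℂ) (hx η)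
    refine tendsto_nhds_unique h1 (h2.congr fun s => ?_)
    exact ((ContinuousLinearMap.isSelfAdjoint_iff_isSymmetric.1
      (IsSelfAdjoint.of_nonneg (hSN s.2).2)) ξ η).symm
  refine ⟨x, ⟨mem_of_commute fun y hy => ?_, ?_⟩, hlub⟩
  · ext ξ
    refine tendsto_nhds_unique ((y.continuous.tendsto _).comp (hx ξ)) ((hx (y ξ)).congr fun s => ?_)
    exact congrArg (fun T : H →L[ℂ] H => T ξ) (hy s (hSN s.2).1)
  · obtain ⟨s, hs⟩ := hne
    exact nonneg_of_quad hsa fun ξ => (quad_nonneg (hSN hs).2 ξ).trans ((hlub ξ).1 ⟨s, hs, rfl⟩)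

theorem exists_isLUB {S : Set (H →L[ℂ] H)} (hSN : S ⊆ posCone N) (hne : S.Nonempty)
    (hd : DirectedOn (· ≤ ·) S) {b : H →L[ℂ] H} (hb : ∀ s ∈ S, s ≤ b) :
    ∃ x ∈ posCone N, IsLUB S x := by
  obtain ⟨x, hx, h⟩ := exists_isLUB_quad hSN hne hd hb
  exact ⟨x, hx, isLUB_of_quad hne (fun s hs => posCone.isSelfAdjoint (hSN hs))
    (posCone.isSelfAdjoint hx) h⟩

/-- The order supremum coincides with the strong limit of the net, whose form is the pointwise
supremum of forms. Vector functionals are therefore normal. -/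
theorem IsLUB.quad {S : Set (H →L[ℂ] H)} (hSN : S ⊆ posCone N) (hne : S.Nonempty)
    (hd : DirectedOn (· ≤ ·) S) {x : H →L[ℂ] H} (hx : IsLUB S x) (ξ : H) :
    IsLUB ((fun s => quad s ξ) '' S) (HoffmanRossi.quad x ξ) := by
  obtain ⟨y, hy, h⟩ := exists_isLUB_quad hSN hne hd hx.1
  have : x = y := hx.unique (isLUB_of_quad hne (fun s hs => posCone.isSelfAdjoint (hSN hs))
    (posCone.isSelfAdjoint hy) h)
  rw [this]
  exact h ξ

/-- Left multiplication by a positive element of a commutative algebra preserves suprema. -/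
theorem isLUB_mul_left (hN : ∀ x ∈ N, ∀ y ∈ N, x * y = y * x) {S : Set (H →L[ℂ] H)}
    (hSN : S ⊆ posCone N) (hne : S.Nonempty) (hd : DirectedOn (· ≤ ·) S) {x : H →L[ℂ] H}
    (hxN : x ∈ posCone N) (hx : IsLUB S x) {y : H →L[ℂ] H} (hy : y ∈ posCone N) :
    IsLUB ((fun s => y * s) '' S) (y * x) := by
  obtain ⟨r, hr, rfl⟩ := exists_sqrt_mem hy
  -- Commutativity turns `y s` into the compression `r s r`, whose form at `ξ` is that of `s` at `r
  -- ξ`.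
  have hc : ∀ s ∈ N, r * r * s = r * s * r := fun s hs => by
    rw [mul_assoc, mul_assoc, hN r hr.1 s hs]
  have hrs := posCone.isSelfAdjoint hr
  have hsa : ∀ s ∈ posCone N, IsSelfAdjoint (r * r * s) := fun s hs => by
    rw [hc s hs.1]
    have := (posCone.isSelfAdjoint hs).conjugate r
    rwa [hrs.star_eq] at this
  refine isLUB_of_quad (hne.image _) ?_ (hsa x hxN) fun ξ => ?_
  · rintro _ ⟨s, hs, rfl⟩
    exact hsa s (hSN hs)
  · have := IsLUB.quad hSN hne hd hx (r ξ)
    rw [Set.image_image]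
    rw [hc x hxN.1, quad_conj hrs]
    convert this using 1
    refine Set.image_congr fun s hs => ?_
    rw [hc s (hSN hs).1, quad_conj hrs]

theorem posCone.mul_mem (hN : ∀ x ∈ N, ∀ y ∈ N, x * y = y * x) {x y : H →L[ℂ] H}
    (hx : x ∈ posCone N) (hy : y ∈ posCone N) : x * y ∈ posCone N :=
  ⟨MulMemClass.mul_mem hx.1 hy.1, Commute.mul_nonneg hx.2 hy.2 (hN x hx.1 y hy.1)⟩

theorem mul_le_of_le_one (hN : ∀ x ∈ N, ∀ y ∈ N, x * y = y * x) {x y : H →L[ℂ] H}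
    (hx : x ∈ posCone N) (hy : y ∈ posCone N) (hy1 : y ≤ 1) : y * x ≤ x := by
  have := (posCone.mul_mem hN (posCone.sub_mem posCone.one_mem hy hy1) hx).2
  rw [sub_mul, one_mul] at this
  exact sub_nonneg.1 this

theorem mul_le_mul_of_le (hN : ∀ x ∈ N, ∀ y ∈ N, x * y = y * x) {x y z : H →L[ℂ] H}
    (hx : x ∈ posCone N) (hy : y ∈ posCone N) (hz : z ∈ posCone N) (h : x ≤ y) :
    z * x ≤ z * y := by
  have := (posCone.mul_mem hN hz (posCone.sub_mem hy hx h)).2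
  rw [mul_sub] at this
  exact sub_nonneg.1 this

/-- Every positive element is a positive multiple of a positive contraction. -/
theorem exists_smul_le_one {x : H →L[ℂ] H} (hx : x ∈ posCone N) :
    ∃ (t : ℝ≥0) (y : H →L[ℂ] H), y ∈ posCone N ∧ y ≤ 1 ∧ 0 < t ∧ x = ((t : ℝ) : ℂ) • y := by
  have ht : (0 : ℝ) < ‖x‖ + 1 := by positivity
  refine ⟨⟨‖x‖ + 1, ht.le⟩, (((‖x‖ + 1)⁻¹ : ℝ) : ℂ) • x, posCone.smul_mem (by positivity) hx,
    ?_, ht, ?_⟩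
  · refine le_of_quad (posCone.isSelfAdjoint (posCone.smul_mem (N := N) (by positivity) hx))
      (IsSelfAdjoint.one _) fun ξ => ?_
    rw [quad_real_smul]
    have h1 := quad_le_norm x ξ
    have h2 : quad (1 : H →L[ℂ] H) ξ = ‖ξ‖ ^ 2 := by
      simpa using quad_mul_self (IsSelfAdjoint.one (H →L[ℂ] H)) ξ
    rw [h2, inv_mul_le_iff₀ ht]
    nlinarith [sq_nonneg ‖ξ‖]
  · change x = ((‖x‖ + 1 : ℝ) : ℂ) • _
    rw [smul_smul, ← Complex.ofReal_mul, mul_inv_cancel₀ ht.ne']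
    simp

/-- The soft supremum `a + b - ab` of two positive contractions. -/
theorem softSup (hN : ∀ x ∈ N, ∀ y ∈ N, x * y = y * x) {a b : H →L[ℂ] H}
    (ha : a ∈ posCone N) (hb : b ∈ posCone N) (ha1 : a ≤ 1) (hb1 : b ≤ 1) :
    a + (1 - a) * b ∈ posCone N ∧ a + (1 - a) * b ≤ 1 ∧ a ≤ a + (1 - a) * b ∧
      b ≤ a + (1 - a) * b ∧ a + (1 - a) * b ≤ a + b := by
  have ha' := posCone.sub_mem posCone.one_mem ha ha1
  have hb' := posCone.sub_mem posCone.one_mem hb hb1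
  have h1 := posCone.mul_mem hN ha' hb
  refine ⟨posCone.add_mem ha h1, ?_, le_add_of_nonneg_right h1.2, ?_, ?_⟩
  -- The soft supremum is `1 - (1 - a)(1 - b)`, whence the bound by `1`; it exceeds `b` by `a (1 -
  -- b)`.
  · have := (posCone.mul_mem hN ha' hb').2
    rw [← sub_nonneg]
    convert this using 1
    noncomm_ring
  · have := (posCone.mul_mem hN ha hb').2
    rw [← sub_nonneg]
    convert this using 1
    noncomm_ring
  · exact add_le_add le_rfl (mul_le_of_le_one hN hb ha' (sub_le_self _ ha.2))

/-- Every element of a von Neumann algebra is a combination of four positive ones. -/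
theorem exists_posCone_decomp {x : H →L[ℂ] H} (hx : x ∈ N) :
    ∃ p : Fin 4 → H →L[ℂ] H, (∀ k, p k ∈ posCone N) ∧
      x = ∑ k : Fin 4, Complex.I ^ (k : ℕ) • p k := by
  have key : ∀ h ∈ N, IsSelfAdjoint h → ∃ a ∈ posCone N, ∃ b ∈ posCone N, h = a - b := by
    intro h hh hs
    have h1 : ∀ ξ, |quad h ξ| ≤ ‖h‖ * ‖ξ‖ ^ 2 := fun ξ => by
      rw [abs_le]
      refine ⟨?_, quad_le_norm h ξ⟩
      have := quad_le_norm (-h) ξ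
      simp only [norm_neg, quad, neg_apply, inner_neg_right,
        Complex.neg_re] at this
      simp only [quad]
      linarith
    have h2 : ∀ ξ, quad (((‖h‖ : ℝ) : ℂ) • (1 : H →L[ℂ] H)) ξ = ‖h‖ * ‖ξ‖ ^ 2 := fun ξ => by
      rw [quad_real_smul]
      simpa using Or.inl (quad_mul_self (IsSelfAdjoint.one (H →L[ℂ] H)) ξ)
    have h3 : ((‖h‖ : ℝ) : ℂ) • (1 : H →L[ℂ] H) ∈ posCone N :=
      posCone.smul_mem (norm_nonneg h) posCone.one_mem
    refine ⟨_, h3, ((‖h‖ : ℝ) : ℂ) • (1 : H →L[ℂ] H) - h, ⟨sub_mem h3.1 hh, ?_⟩, by abel⟩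
    refine nonneg_of_quad ((posCone.isSelfAdjoint h3).sub hs) fun ξ => ?_
    rw [quad_sub, h2]
    linarith [(abs_le.1 (h1 ξ)).2]
  have hxs : star x ∈ N := star_mem hx
  obtain ⟨a, ha, b, hb, hab⟩ := key ((1 / 2 : ℂ) • (x + star x))
    (smul_mem_vN _ (add_mem hx hxs)) (by
      rw [IsSelfAdjoint, star_smul, star_add, star_star, add_comm]; simp)
  obtain ⟨c, hc, d, hd, hcd⟩ := key ((-Complex.I / 2 : ℂ) • (x - star x))
    (smul_mem_vN _ (sub_mem hx hxs)) (by
      rw [IsSelfAdjoint, star_smul, star_sub, star_star, ← neg_sub x, smul_neg, ← neg_smul]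
      simp [neg_div])
  refine ⟨![a, c, b, d], ?_, ?_⟩
  · intro k
    fin_cases k <;> assumption
  · have h1 : x = ((1 / 2 : ℂ) • (x + star x)) + Complex.I • ((-Complex.I / 2 : ℂ) • (x - star x)) := by
      rw [smul_smul]
      have : Complex.I * (-Complex.I / 2) = 1 / 2 := by
        rw [mul_div_assoc', mul_neg, Complex.I_mul_I, neg_neg]
      rw [this, ← smul_add]
      have : x + star x + (x - star x) = (2 : ℂ) • x := by rw [two_smul]; abel
      rw [this, smul_smul]; simp
    rw [hab, hcd] at h1
    rw [h1, Fin.sum_univ_four]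
    simp [Complex.I_pow_three, smul_sub]
    abel

end

/-! ### Normal weights, Hahn decomposition and Radon–Nikodym. -/

section

variable {N D M : VonNeumannAlgebra H}

/-- `φ`, considered on the positive cone of `N`, is a normal weight. -/
structure NormalOn (N : VonNeumannAlgebra H) (φ : (H →L[ℂ] H) → ℝ≥0∞) : Prop where
  add : ∀ x ∈ posCone N, ∀ y ∈ posCone N, φ (x + y) = φ x + φ y
  smul : ∀ (t : ℝ≥0), ∀ x ∈ posCone N, φ (((t : ℝ) : ℂ) • x) = t * φ x
  sup : ∀ S ⊆ posCone N, S.Nonempty → DirectedOn (· ≤ ·) S → ∀ x ∈ posCone N, IsLUB S x →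
    φ x = ⨆ s ∈ S, φ s

namespace NormalOn

variable {φ α β : (H →L[ℂ] H) → ℝ≥0∞}

theorem mono (hφ : NormalOn N φ) {x y : H →L[ℂ] H} (hx : x ∈ posCone N) (hy : y ∈ posCone N)
    (h : x ≤ y) : φ x ≤ φ y := by
  have := hφ.add x hx (y - x) (posCone.sub_mem hy hx h)
  rw [add_sub_cancel] at this
  rw [this]
  exact le_self_add

theorem map_zero (hφ : NormalOn N φ) : φ 0 = 0 := by
  have := hφ.smul 0 0 posCone.zero_mem
  simpa using this

theorem add_sub (hφ : NormalOn N φ) {x y : H →L[ℂ] H} (hx : x ∈ posCone N) (hy : y ∈ posCone N)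
    (h : x ≤ y) : φ y = φ x + φ (y - x) := by
  have := hφ.add x hx (y - x) (posCone.sub_mem hy hx h)
  rwa [add_sub_cancel] at this

theorem zero : NormalOn N (fun _ => 0) := ⟨by simp, by simp, by simp⟩

theorem of_subset (hDM : (D : Set (H →L[ℂ] H)) ⊆ M) (hφ : NormalOn M φ) : NormalOn D φ := by
  have h : posCone D ⊆ posCone M := fun x hx => ⟨hDM hx.1, hx.2⟩
  exact ⟨fun x hx y hy => hφ.add x (h hx) y (h hy), fun t x hx => hφ.smul t x (h hx),
    fun S hS hne hd x hx => hφ.sup S (hS.trans h) hne hd x (h hx)⟩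

theorem mul_left (hN : ∀ x ∈ N, ∀ y ∈ N, x * y = y * x) (hφ : NormalOn N φ) {d : H →L[ℂ] H}
    (hd : d ∈ posCone N) : NormalOn N (fun x => φ (d * x)) := by
  refine ⟨fun x hx y hy => ?_, fun t x hx => ?_, fun S hS hne hdir x hx hlub => ?_⟩
  · rw [mul_add]
    exact hφ.add _ (posCone.mul_mem hN hd hx) _ (posCone.mul_mem hN hd hy)
  · rw [mul_smul_comm]
    exact hφ.smul t _ (posCone.mul_mem hN hd hx)
  · rw [hφ.sup ((fun s => d * s) '' S) ?_ (hne.image _) ?_ _ (posCone.mul_mem hN hd hx)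
      (isLUB_mul_left hN hS hne hdir hx hlub hd), iSup_image]
    · rintro _ ⟨s, hs, rfl⟩
      exact posCone.mul_mem hN hd (hS hs)
    · rintro _ ⟨s, hs, rfl⟩ _ ⟨t, ht, rfl⟩
      obtain ⟨u, hu, h1, h2⟩ := hdir s hs t ht
      exact ⟨_, ⟨u, hu, rfl⟩, mul_le_mul_of_le hN (hS hs) (hS hu) hd h1,
        mul_le_mul_of_le hN (hS ht) (hS hu) hd h2⟩

theorem add_weight (hα : NormalOn N α) (hβ : NormalOn N β) : NormalOn N (fun x => α x + β x) := by
  refine ⟨fun x hx y hy => ?_, fun t x hx => ?_, fun S hS hne hdir x hx hlub => ?_⟩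
  · rw [hα.add x hx y hy, hβ.add x hx y hy]
    abel
  · rw [hα.smul t x hx, hβ.smul t x hx, mul_add]
  · rw [hα.sup S hS hne hdir x hx hlub, hβ.sup S hS hne hdir x hx hlub]
    simp only [iSup_subtype']
    refine ENNReal.iSup_add_iSup fun i j => ?_
    obtain ⟨k, hk, h1, h2⟩ := hdir i i.2 j j.2
    exact ⟨⟨k, hk⟩, add_le_add (hα.mono (hS i.2) (hS hk) h1) (hβ.mono (hS j.2) (hS hk) h2)⟩

theorem const_mul (hα : NormalOn N α) (t : ℝ≥0) : NormalOn N (fun x => t * α x) := by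
  refine ⟨fun x hx y hy => ?_, fun s x hx => ?_, fun S hS hne hdir x hx hlub => ?_⟩
  · rw [hα.add x hx y hy, mul_add]
  · rw [hα.smul s x hx, mul_left_comm]
  · rw [hα.sup S hS hne hdir x hx hlub]
    simp only [ENNReal.mul_iSup]

/-- Suprema commute with suprema, which gives normality; directedness is what additivity needs. Used
for infinite sums and for upper bounds of chains of weights. -/
theorem iSup_comm_of_directed {ι : Type*} [Nonempty ι] {f : ι → (H →L[ℂ] H) → ℝ≥0∞}
    (hf : ∀ i, NormalOn N (f i)) (hd : ∀ i j, ∃ k, (∀ x, f i x ≤ f k x) ∧ ∀ x, f j x ≤ f k x) :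
    NormalOn N (fun x => ⨆ i, f i x) := by
  refine ⟨fun x hx y hy => ?_, fun t x hx => ?_, fun S hS hne hdir x hx hlub => ?_⟩
  · simp only [(hf _).add x hx y hy]
    refine (ENNReal.iSup_add_iSup fun i j => ?_).symm
    obtain ⟨k, h1, h2⟩ := hd i j
    exact ⟨k, add_le_add (h1 x) (h2 y)⟩
  · simp only [(hf _).smul t x hx, ENNReal.mul_iSup]
  · simp only [fun i => (hf i).sup S hS hne hdir x hx hlub]
    rw [iSup_comm]
    exact iSup_congr fun s => iSup_comm

theorem finset_sum {ι : Type*} {f : ι → (H →L[ℂ] H) → ℝ≥0∞} (hf : ∀ i, NormalOn N (f i))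
    (s : Finset ι) : NormalOn N (fun x => ∑ i ∈ s, f i x) := by
  classical
  induction s using Finset.induction_on with
  | empty => simpa using zero
  | insert a s ha ih =>
    simp only [Finset.sum_insert ha]
    exact (hf a).add_weight ih

theorem tsum {ι : Type*} {f : ι → (H →L[ℂ] H) → ℝ≥0∞} (hf : ∀ i, NormalOn N (f i)) :
    NormalOn N (fun x => ∑' i, f i x) := by
  classical
  simp only [ENNReal.tsum_eq_iSup_sum]
  refine iSup_comm_of_directed (fun s => finset_sum hf s) fun s t => ⟨s ∪ t, fun x => ?_, fun x => ?_⟩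
  · exact Finset.sum_le_sum_of_subset Finset.subset_union_left
  · exact Finset.sum_le_sum_of_subset Finset.subset_union_right

/-- The difference of two normal weights, the larger of which is finite. -/
theorem sub (hα : NormalOn N α) (hβ : NormalOn N β) (hle : ∀ x ∈ posCone N, β x ≤ α x)
    (hfin : ∀ x ∈ posCone N, α x ≠ ∞) : NormalOn N (fun x => α x - β x) := by
  have hb : ∀ x ∈ posCone N, β x ≠ ∞ := fun x hx => ne_top_of_le_ne_top (hfin x hx) (hle x hx)
  have hadd : ∀ x ∈ posCone N, ∀ y ∈ posCone N,
      α (x + y) - β (x + y) = (α x - β x) + (α y - β y) := by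
    intro x hx y hy
    refine ENNReal.sub_eq_of_eq_add (hb _ (posCone.add_mem hx hy)) ?_
    rw [hα.add x hx y hy, hβ.add x hx y hy]
    calc α x + α y = ((α x - β x) + β x) + ((α y - β y) + β y) := by
          rw [tsub_add_cancel_of_le (hle x hx), tsub_add_cancel_of_le (hle y hy)]
      _ = _ := add_add_add_comm _ _ _ _
  refine ⟨hadd, fun t x hx => ?_, fun S hS hne hdir x hx hlub => le_antisymm ?_ ?_⟩
  · rw [hα.smul t x hx, hβ.smul t x hx, ENNReal.mul_sub]
    simp
  -- `α x - β x` is the supremum of `α s - β x`, and `β s ≤ β x`.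
  · rw [hα.sup S hS hne hdir x hx hlub, ENNReal.iSup_sub]
    simp only [ENNReal.iSup_sub]
    refine iSup₂_mono fun s hs => ?_
    exact tsub_le_tsub_left (hβ.mono (hS hs) hx (hlub.1 hs)) _
  · refine iSup₂_le fun s hs => ?_
    have := hadd s (hS hs) (x - s) (posCone.sub_mem hx (hS hs) (hlub.1 hs))
    rw [add_sub_cancel] at this
    rw [this]
    exact le_self_add

end NormalOn

variable {φ α β : (H →L[ℂ] H) → ℝ≥0∞}

/-- A Hahn decomposition argument: if `α d < β d`, then there is a nonzero `y ≤ d` such that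
`α ≤ β` below `y`. -/
theorem exists_le_below (hα : NormalOn N α) (hβ : NormalOn N β) {d : H →L[ℂ] H}
    (hd : d ∈ posCone N) (h : α d < β d) :
    ∃ y ∈ posCone N, y ≤ d ∧ α y < β y ∧ ∀ z ∈ posCone N, z ≤ y → α z ≤ β z := by
  -- By normality `T` is closed under suprema of chains. A maximal `t` exhausts the part of `d`
  -- where `α` dominates, and `d - t` is what is wanted.
  let T : Set (H →L[ℂ] H) := {t | t ∈ posCone N ∧ t ≤ d ∧ β t ≤ α t}
  have h0 : (0 : H →L[ℂ] H) ∈ T := ⟨posCone.zero_mem, hd.2, by rw [hα.map_zero, hβ.map_zero]⟩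
  obtain ⟨t, -, ht⟩ := zorn_le_nonempty₀ T (fun C hC hchain c hc => by
    have hCN : C ⊆ posCone N := fun c hc => (hC hc).1
    obtain ⟨x, hx, hlub⟩ := exists_isLUB hCN ⟨c, hc⟩ hchain.directedOn fun s hs => (hC hs).2.1
    refine ⟨x, ⟨hx, hlub.2 fun s hs => (hC hs).2.1, ?_⟩, hlub.1⟩
    rw [hβ.sup C hCN ⟨c, hc⟩ hchain.directedOn x hx hlub,
      hα.sup C hCN ⟨c, hc⟩ hchain.directedOn x hx hlub]
    exact iSup₂_mono fun s hs => (hC hs).2.2) 0 h0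
  obtain ⟨htN, htd, hβα⟩ := ht.prop
  have hy := posCone.sub_mem hd htN htd
  refine ⟨d - t, hy, sub_le_self _ htN.2, ?_, fun z hz hzy => ?_⟩
  · rw [hα.add_sub htN hd htd, hβ.add_sub htN hd htd] at h
    by_contra hcon
    exact absurd (add_le_add hβα (not_lt.1 hcon)) (not_le.2 h)
  · by_contra hcon
    have hmem : t + z ∈ T := by
      refine ⟨posCone.add_mem htN hz, ?_, ?_⟩
      · have := add_le_add (le_refl t) hzy
        rwa [add_sub_cancel] at this
      · rw [hα.add t htN z hz, hβ.add t htN z hz]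
        exact add_le_add hβα (not_le.1 hcon).le
    have h1 := ht.le_of_ge hmem (le_add_of_nonneg_right hz.2)
    have h2 : z = 0 := le_antisymm (by simpa using h1) hz.2
    rw [h2, hα.map_zero, hβ.map_zero] at hcon
    exact hcon le_rfl

/-- Radon–Nikodym: if `α ≤ β` then `α = β (c ·)` for a positive contraction `c`, wherever `β` is
finite. -/
theorem exists_density (hN : ∀ x ∈ N, ∀ y ∈ N, x * y = y * x)
    (hα : NormalOn N α) (hβ : NormalOn N β) (hle : ∀ x ∈ posCone N, α x ≤ β x) :
    ∃ c ∈ posCone N, c ≤ 1 ∧ ∀ x ∈ posCone N, β x ≠ ∞ → α x = β (c * x) := by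
  -- The density is a maximal `c` with `β (c ·) ≤ α`; normality of `β (x ·)` provides upper bounds
  -- of chains.
  let T : Set (H →L[ℂ] H) := {c | c ∈ posCone N ∧ c ≤ 1 ∧ ∀ x ∈ posCone N, β (c * x) ≤ α x}
  have h0 : (0 : H →L[ℂ] H) ∈ T := ⟨posCone.zero_mem, zero_le_one, fun x _ => by
    rw [zero_mul, hβ.map_zero]; exact zero_le⟩
  obtain ⟨c, -, hc⟩ := zorn_le_nonempty₀ T (fun C hC hchain c hc => by
    have hCN : C ⊆ posCone N := fun c hc => (hC hc).1
    obtain ⟨b, hb, hlub⟩ := exists_isLUB hCN ⟨c, hc⟩ hchain.directedOn fun s hs => (hC hs).2.1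
    refine ⟨b, ⟨hb, hlub.2 fun s hs => (hC hs).2.1, fun x hx => ?_⟩, hlub.1⟩
    have := (hβ.mul_left hN hx).sup C hCN ⟨c, hc⟩ hchain.directedOn b hb hlub
    rw [hN b hb.1 x hx.1, this]
    refine iSup₂_le fun s hs => ?_
    rw [hN x hx.1 s (hCN hs).1]
    exact (hC hs).2.2 x hx) 0 h0
  obtain ⟨hcN, hc1, hcα⟩ := hc.prop
  suffices key : ∀ x ∈ posCone N, x ≤ 1 → β x ≠ ∞ → α x ≤ β (c * x) by
    refine ⟨c, hcN, hc1, fun x hx hfin => le_antisymm ?_ (hcα x hx)⟩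
    obtain ⟨t, y, hy, hy1, ht, rfl⟩ := exists_smul_le_one hx
    rw [mul_smul_comm, hα.smul t y hy, hβ.smul t _ (posCone.mul_mem hN hcN hy)]
    gcongr
    refine key y hy hy1 fun h => hfin ?_
    rw [hβ.smul t y hy, h, ENNReal.mul_top (by exact_mod_cast ht.ne')]
  intro x hx hx1 hfin
  by_contra hcon
  rw [not_le] at hcon
  have hcx : β (c * x) ≠ ∞ := hcon.ne_top
  -- If `c` falls short at `x`, there is room for a multiple `ε β`; the Hahn argument then finds `y
  -- ≤ x` below which `β (c ·) + ε β ≤ α`.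
  obtain ⟨ε, hε0, hε⟩ : ∃ ε : ℝ≥0, 0 < ε ∧ ε ≤ 1 ∧ β (c * x) + ε * β x < α x := by
    have hpos : 0 < α x - β (c * x) := tsub_pos_of_lt hcon
    have hαx : α x ≠ ∞ := ne_top_of_le_ne_top hfin (hle x hx)
    obtain ⟨δ, hδ0, hδ⟩ := ENNReal.exists_nnreal_pos_mul_lt hfin hpos.ne'
    refine ⟨min δ 1, lt_min hδ0 one_pos, min_le_right _ _, ?_⟩
    calc β (c * x) + (min δ 1 : ℝ≥0) * β x ≤ β (c * x) + δ * β x := by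
          gcongr; exact min_le_left _ _
      _ < β (c * x) + (α x - β (c * x)) := by
          exact ENNReal.add_lt_add_left hcx hδ
      _ = α x := add_tsub_cancel_of_le hcon.le
  obtain ⟨hε1, hε⟩ := hε
  have hα' : NormalOn N (fun x => β (c * x) + ε * β x) :=
    (hβ.mul_left hN hcN).add_weight (hβ.const_mul ε)
  obtain ⟨y, hy, hyx, hlt, hbelow⟩ := exists_le_below hα' hα hx hε
  have hy1 : y ≤ 1 := hyx.trans hx1
  have hc' := posCone.sub_mem posCone.one_mem hcN hc1
  have hy' := posCone.sub_mem posCone.one_mem hy hy1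
  have hyc := posCone.mul_mem hN hy hc'
  -- The competitor is `c + ε y (1 - c)`; the factor `1 - c` keeps it below `1`.
  have hεyc : ((ε : ℝ) : ℂ) • (y * (1 - c)) ∈ posCone N := posCone.smul_mem ε.coe_nonneg hyc
  have hle1 : ((ε : ℝ) : ℂ) • (y * (1 - c)) ≤ 1 - c := by
    refine le_trans ?_ (mul_le_of_le_one hN hc' hy hy1)
    rw [← sub_nonneg]
    have := real_smul_nonneg (t := 1 - ε) (sub_nonneg.2 (by exact_mod_cast hε1)) hyc.2
    convert this using 1
    push_cast
    rw [sub_smul, one_smul]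
  have hbound : ∀ z ∈ posCone N, z ≤ 1 →
      β ((c + ((ε : ℝ) : ℂ) • (y * (1 - c))) * z) ≤ α z := by
    intro z hz hz1
    have hyz := posCone.mul_mem hN hy hz
    have hy'z := posCone.mul_mem hN hy' hz
    have hyzy : y * z ≤ y := by
      rw [hN y hy.1 z hz.1]
      exact mul_le_of_le_one hN hy hz hz1
    have e1 : (c + ((ε : ℝ) : ℂ) • (y * (1 - c))) * z
        = (c * ((1 - y) * z) + c * (y * z)) + ((ε : ℝ) : ℂ) • ((1 - c) * (y * z)) := by
      rw [add_mul, smul_mul_assoc, hN y hy.1 _ hc'.1, mul_assoc]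
      congr 1
      noncomm_ring
    -- On `(1 - y) z` the bound for `c` suffices; `y z` lies below `y`, where the extra `ε β` is
    -- affordable.
    have e2 : z = (1 - y) * z + y * z := by noncomm_ring
    rw [e1, hβ.add _ (posCone.add_mem (posCone.mul_mem hN hcN hy'z) (posCone.mul_mem hN hcN hyz))
      _ (posCone.smul_mem ε.coe_nonneg (posCone.mul_mem hN hc' hyz)),
      hβ.add _ (posCone.mul_mem hN hcN hy'z) _ (posCone.mul_mem hN hcN hyz),
      hβ.smul ε _ (posCone.mul_mem hN hc' hyz), add_assoc]
    conv_rhs => rw [e2, hα.add _ hy'z _ hyz]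
    refine add_le_add (hcα _ hy'z) (le_trans ?_ (hbelow _ hyz hyzy))
    gcongr
    exact hβ.mono (posCone.mul_mem hN hc' hyz) hyz
      (mul_le_of_le_one hN hyz hc' (sub_le_self _ hcN.2))
  have hmem : c + ((ε : ℝ) : ℂ) • (y * (1 - c)) ∈ T := by
    refine ⟨posCone.add_mem hcN hεyc, ?_, fun z hz => ?_⟩
    · have := add_le_add (le_refl c) hle1
      rwa [add_sub_cancel] at this
    · obtain ⟨t, z', hz', hz'1, -, rfl⟩ := exists_smul_le_one hz
      rw [mul_smul_comm, hα.smul t z' hz',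
        hβ.smul t _ (posCone.mul_mem hN (posCone.add_mem hcN hεyc) hz')]
      gcongr
      exact hbound z' hz' hz'1
  -- Maximality forces `c y = y`, and then `α y ≤ β y = β (c y)` contradicts the strict inequality
  -- at `y`.
  have h1 := hc.le_of_ge hmem (le_add_of_nonneg_right hεyc.2)
  have h2 : ((ε : ℝ) : ℂ) • (y * (1 - c)) = 0 := le_antisymm (by simpa using h1) hεyc.2
  have h3 : y * (1 - c) = 0 := by
    refine (smul_eq_zero.1 h2).resolve_left ?_
    exact_mod_cast hε0.ne'
  have h4 : c * y = y := by
    rw [mul_sub, mul_one, sub_eq_zero] at h3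
    rw [hN c hcN.1 y hy.1]
    exact h3.symm
  have h5 : α y < α y := by
    calc α y ≤ β y := hle y hy
      _ ≤ β (c * y) + ε * β y := by rw [h4]; exact le_self_add
      _ < α y := hlt
  exact h5.false

end

/-! ### Finite normal weights as sums of vector functionals. -/

section

variable {N : VonNeumannAlgebra H} {φ : (H →L[ℂ] H) → ℝ≥0∞}

/-- The vector functional `x ↦ ⟪ξ, x ξ⟫`, as a weight. -/
def vecWeight (ξ : H) (x : H →L[ℂ] H) : ℝ≥0∞ := ENNReal.ofReal (quad x ξ)

theorem vecWeight_ne_top (ξ : H) (x : H →L[ℂ] H) : vecWeight ξ x ≠ ∞ := ENNReal.ofReal_ne_top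

theorem quad_one (ξ : H) : quad (1 : H →L[ℂ] H) ξ = ‖ξ‖ ^ 2 := by
  simpa using quad_mul_self (IsSelfAdjoint.one (H →L[ℂ] H)) ξ

theorem vecWeight_one (ξ : H) : vecWeight ξ 1 = ENNReal.ofReal (‖ξ‖ ^ 2) := by
  rw [vecWeight, quad_one]

theorem normalOn_vecWeight (N : VonNeumannAlgebra H) (ξ : H) : NormalOn N (vecWeight ξ) := by
  refine ⟨fun x hx y hy => ?_, fun t x hx => ?_, fun S hS hne hdir x hx hlub => ?_⟩
  · rw [vecWeight, quad_add, ENNReal.ofReal_add (quad_nonneg hx.2 ξ) (quad_nonneg hy.2 ξ)]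
    rfl
  · rw [vecWeight, quad_real_smul, ENNReal.ofReal_mul t.coe_nonneg, ENNReal.ofReal_coe_nnreal]
    rfl
  · have h1 := IsLUB.quad hS hne hdir hlub ξ
    have h2 := h1.isLUB_of_tendsto (f := ENNReal.ofReal) (ENNReal.ofReal_mono.monotoneOn _)
      (hne.image _) (ENNReal.continuous_ofReal.continuousWithinAt)
    rw [Set.image_image] at h2
    rw [vecWeight, ← h2.sSup_eq, sSup_image]
    rfl

theorem NormalOn.ne_top (hφ : NormalOn N φ) (h1 : φ 1 ≠ ∞) {x : H →L[ℂ] H} (hx : x ∈ posCone N) :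
    φ x ≠ ∞ := by
  obtain ⟨t, y, hy, hy1, -, rfl⟩ := exists_smul_le_one hx
  rw [hφ.smul t y hy]
  exact ENNReal.mul_ne_top ENNReal.coe_ne_top
    (ne_top_of_le_ne_top h1 (hφ.mono hy posCone.one_mem hy1))

/-- Inequalities between weights can be tested on contractions. -/
theorem NormalOn.le_of_le_one {α β : (H →L[ℂ] H) → ℝ≥0∞} (hα : NormalOn N α) (hβ : NormalOn N β)
    (h : ∀ x ∈ posCone N, x ≤ 1 → α x ≤ β x) {x : H →L[ℂ] H} (hx : x ∈ posCone N) :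
    α x ≤ β x := by
  obtain ⟨t, y, hy, hy1, -, rfl⟩ := exists_smul_le_one hx
  rw [hα.smul t y hy, hβ.smul t y hy]
  gcongr
  exact h y hy hy1

/-- Suprema of families of positive contractions closed under `a + (1 - a) b`. -/
theorem exists_greatest_of_softSup (hN : ∀ x ∈ N, ∀ y ∈ N, x * y = y * x)
    {S : Set (H →L[ℂ] H)} (hS : ∀ s ∈ S, s ∈ posCone N ∧ s ≤ 1) (hne : S.Nonempty)
    (hsoft : ∀ a ∈ S, ∀ b ∈ S, a + (1 - a) * b ∈ S) :
    DirectedOn (· ≤ ·) S ∧ ∃ s ∈ posCone N, IsLUB S s := by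
  have hd : DirectedOn (· ≤ ·) S := fun a ha b hb =>
    ⟨_, hsoft a ha b hb, (softSup hN (hS a ha).1 (hS b hb).1 (hS a ha).2 (hS b hb).2).2.2.1,
      (softSup hN (hS a ha).1 (hS b hb).1 (hS a ha).2 (hS b hb).2).2.2.2.1⟩
  exact ⟨hd, exists_isLUB (fun s hs => (hS s hs).1) hne hd fun s hs => (hS s hs).2⟩

/-- Off the largest `φ`-null projection `s`, choose a vector `ξ` so long that `φ (1 - s) < ⟪ξ, (1 -
s) ξ⟫`. Hahn gives `y ≤ 1 - s` below which `φ` is dominated by `⟪ξ, · ξ⟫`, and Radon–Nikodym turns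
`φ (y² ·)` into the functional of `r ξ`, with `r² = y² c`. It is at most `φ`. -/
theorem exists_vecWeight_le (hN : ∀ x ∈ N, ∀ y ∈ N, x * y = y * x) (hφ : NormalOn N φ)
    (h1 : φ 1 ≠ ∞) (h0 : φ 1 ≠ 0) :
    ∃ ξ : H, ξ ≠ 0 ∧ ∀ x ∈ posCone N, vecWeight ξ x ≤ φ x := by
  let S : Set (H →L[ℂ] H) := {w | (w ∈ posCone N ∧ w ≤ 1) ∧ φ w = 0}
  have hsoft : ∀ a ∈ S, ∀ b ∈ S, a + (1 - a) * b ∈ S := by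
    rintro a ⟨⟨ha, ha1⟩, ha0⟩ b ⟨⟨hb, hb1⟩, hb0⟩
    obtain ⟨h2, h3, -, -, h4⟩ := softSup hN ha hb ha1 hb1
    refine ⟨⟨h2, h3⟩, le_antisymm ?_ zero_le⟩
    calc _ ≤ φ (a + b) := hφ.mono h2 (posCone.add_mem ha hb) h4
      _ = 0 := by rw [hφ.add a ha b hb, ha0, hb0, add_zero]
  have hSne : S.Nonempty := ⟨0, ⟨posCone.zero_mem, zero_le_one⟩, hφ.map_zero⟩
  obtain ⟨hSd, s, hs, hlub⟩ := exists_greatest_of_softSup hN (S := S) (fun s hs => hs.1) hSne hsoft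
  have hs1 : s ≤ 1 := hlub.2 fun w hw => hw.1.2
  have hsS : s ∈ S := by
    refine ⟨⟨hs, hs1⟩, ?_⟩
    rw [hφ.sup S (fun w hw => hw.1.1) hSne hSd s hs hlub]
    simp only [ENNReal.iSup_eq_zero]
    exact fun w hw => hw.2
  have hs' := posCone.sub_mem posCone.one_mem hs hs1
  -- The soft supremum of `s` with itself is again null, hence at most `s`; so `s` is a projection.
  have hidem : s * s = s := by
    have h2 : (1 - s) * s ≤ 0 := by simpa using hlub.1 (hsoft s hsS s hsS)
    have h3 := le_antisymm h2 (posCone.mul_mem hN hs' hs).2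
    rw [sub_mul, one_mul, sub_eq_zero] at h3
    exact h3.symm
  have hsne : (1 - s : H →L[ℂ] H) ≠ 0 := fun h => by
    rw [sub_eq_zero] at h
    exact h0 (h ▸ hsS.2)
  obtain ⟨η, hη⟩ : ∃ η, (1 - s) η ≠ 0 := by
    by_contra! hcon
    exact hsne (ContinuousLinearMap.ext hcon)
  obtain ⟨t, ht⟩ : ∃ t : ℝ, φ 1 < ENNReal.ofReal (t ^ 2 * ‖(1 - s) η‖ ^ 2) := by
    have hpos : 0 < ‖(1 - s) η‖ ^ 2 := by positivity
    refine ⟨Real.sqrt (((φ 1).toReal + 1) / ‖(1 - s) η‖ ^ 2), ?_⟩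
    rw [Real.sq_sqrt (by positivity), div_mul_cancel₀ _ hpos.ne',
      ENNReal.lt_ofReal_iff_toReal_lt h1]
    linarith
  set ξ : H := (t : ℂ) • (1 - s) η with hξ
  have hsξ : s ξ = 0 := by
    have : s ((1 - s) η) = 0 := by
      have h2 : s * (1 - s) = 0 := by rw [mul_sub, mul_one, hidem, sub_self]
      exact congrArg (fun T : H →L[ℂ] H => T η) h2
    rw [hξ, map_smul, this, smul_zero]
  have hlt : φ (1 - s) < vecWeight ξ (1 - s) := by
    have h2 : quad (1 - s) ξ = t ^ 2 * ‖(1 - s) η‖ ^ 2 := by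
      have h3 : quad s ξ = 0 := by simp [quad, hsξ]
      rw [quad_sub, h3, sub_zero, hξ, quad_vec_smul, quad_one]
    rw [vecWeight, h2]
    exact (hφ.mono hs' posCone.one_mem (sub_le_self _ hs.2)).trans_lt ht
  obtain ⟨y, hy, hys, hylt, hbelow⟩ := exists_le_below hφ (normalOn_vecWeight N ξ) hs' hlt
  have hy1 : y ≤ 1 := hys.trans (sub_le_self _ hs.2)
  have hyy := posCone.mul_mem hN hy hy
  have hyy1 : y * y ≤ 1 := (mul_le_of_le_one hN hy hy hy1).trans hy1
  have hα := hφ.mul_left hN hyy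
  have hβ := (normalOn_vecWeight N ξ).mul_left hN hyy
  obtain ⟨c, hc, hc1, hceq⟩ := exists_density hN hα hβ fun x hx =>
    hα.le_of_le_one hβ (fun z hz hz1 => by
      refine hbelow _ (posCone.mul_mem hN hyy hz) ?_
      rw [mul_assoc, hN y hy.1 (y * z) (mul_mem hy.1 hz.1)]
      exact mul_le_of_le_one hN hy (posCone.mul_mem hN hy hz)
        ((mul_le_of_le_one hN hz hy hy1).trans hz1)) hx
  obtain ⟨r, hr, hrr⟩ := exists_sqrt_mem (posCone.mul_mem hN hyy hc)
  have hrs := posCone.isSelfAdjoint hr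
  have heq : ∀ x ∈ posCone N, vecWeight (r ξ) x = φ (y * y * x) := by
    intro x hx
    rw [hceq x hx (vecWeight_ne_top _ _), ← mul_assoc, ← hrr, vecWeight, vecWeight,
      ← quad_conj hrs, mul_assoc, mul_assoc, hN x hx.1 r hr.1]
  -- If `r ξ = 0` then `y²` is null, so `y² ≤ s`; as `s ξ = 0`, this gives `y ξ = 0`, contrary to `φ
  -- y < ⟪ξ, y ξ⟫`.
  refine ⟨r ξ, fun hzero => ?_, fun x hx => ?_⟩
  · have h2 := heq 1 posCone.one_mem
    rw [hzero, mul_one, vecWeight_one] at h2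
    have h3 : y * y ≤ s := hlub.1 ⟨⟨hyy, hyy1⟩, by simpa using h2.symm⟩
    have h4 := quad_mono h3 ξ
    rw [quad_mul_self (posCone.isSelfAdjoint hy)] at h4
    have h5 : quad s ξ = 0 := by simp [quad, hsξ]
    have h6 : y ξ = 0 := by
      rw [h5] at h4
      have : ‖y ξ‖ = 0 := by nlinarith [norm_nonneg (y ξ)]
      simpa using this
    have h7 : vecWeight ξ y = 0 := by simp [vecWeight, quad, h6]
    rw [h7] at hylt
    exact not_lt_zero hylt
  · rw [heq x hx]
    exact hφ.mono (posCone.mul_mem hN hyy hx) hx (mul_le_of_le_one hN hx hyy hyy1)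

/-- A finite normal weight on a commutative von Neumann algebra is a countable sum of vector
functionals. -/
theorem exists_eq_tsum_vecWeight (hN : ∀ x ∈ N, ∀ y ∈ N, x * y = y * x) (hφ : NormalOn N φ)
    (h1 : φ 1 ≠ ∞) :
    ∃ ζ : lp (fun _ : ℕ => H) 2, ∀ x ∈ posCone N, φ x = ∑' n, vecWeight (ζ n) x := by
  classical
  -- A maximal family of nonzero vectors whose functionals sum to at most `φ`; the label in `ℕ` lets
  -- a vector occur repeatedly.
  let 𝓕 : Set (Set (H × ℕ)) := {F | (∀ p ∈ F, p.1 ≠ 0) ∧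
    ∀ s : Finset (H × ℕ), (s : Set (H × ℕ)) ⊆ F → ∀ x ∈ posCone N,
      ∑ p ∈ s, vecWeight p.1 x ≤ φ x}
  obtain ⟨F, -, hF⟩ := zorn_subset_nonempty 𝓕 (fun C hC hchain hne => by
    refine ⟨⋃₀ C, ⟨?_, fun s hs x hx => ?_⟩, fun s hs => Set.subset_sUnion_of_mem hs⟩
    · rintro p ⟨G, hG, hp⟩
      exact (hC hG).1 p hp
    · obtain ⟨G, hG, hsG⟩ := hchain.directedOn.exists_mem_subset_of_finite_of_subset_sUnion
        hne s.finite_toSet hs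
      exact (hC hG).2 s hsG x hx) ∅
    ⟨by simp, fun s hs x hx => by
      rw [Set.subset_empty_iff, Finset.coe_eq_empty] at hs
      simp [hs]⟩
  obtain ⟨hF0, hFle⟩ := hF.prop
  let v : (H →L[ℂ] H) → ℝ≥0∞ := fun x => ∑' p : F, vecWeight p.1.1 x
  have hv : NormalOn N v := NormalOn.tsum fun p => normalOn_vecWeight N p.1.1
  have hvle : ∀ x ∈ posCone N, v x ≤ φ x := by
    intro x hx
    simp only [v, ENNReal.tsum_eq_iSup_sum]
    refine iSup_le fun s => ?_
    have := hFle (s.map (Function.Embedding.subtype _)) (by simp) x hx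
    simpa using this
  have hψ : NormalOn N (fun x => φ x - v x) := hφ.sub hv hvle fun x hx => hφ.ne_top h1 hx
  have hψ0 : φ 1 - v 1 = 0 := by
    by_contra hne
    obtain ⟨ξ, hξ, hle⟩ := exists_vecWeight_le hN hψ (ENNReal.sub_ne_top h1) hne
    have hpos : vecWeight ξ 1 ≠ 0 := by
      rw [vecWeight_one, Ne, ENNReal.ofReal_eq_zero, not_le]
      positivity
    -- A label is still free: arbitrarily many copies of `ξ` would make the sum at `1` exceed `φ 1`.
    obtain ⟨n, hn⟩ : ∃ n : ℕ, (ξ, n) ∉ F := by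
      by_contra! hall
      obtain ⟨k, hk⟩ := ENNReal.exists_nat_mul_gt hpos h1
      have := hFle ((Finset.range k).image fun n => (ξ, n)) (by
        intro p hp
        simp only [Finset.coe_image, Set.mem_image] at hp
        obtain ⟨n, -, rfl⟩ := hp
        exact hall n) 1 posCone.one_mem
      rw [Finset.sum_image (by simp)] at this
      simp only [Finset.sum_const, Finset.card_range, nsmul_eq_mul] at this
      exact absurd this (not_le.2 hk)
    have hmem : insert (ξ, n) F ∈ 𝓕 := by
      refine ⟨?_, fun s hs x hx => ?_⟩
      · rintro p (rfl | hp)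
        · exact hξ
        · exact hF0 p hp
      · have h2 : ∑ p ∈ s.erase (ξ, n), vecWeight p.1 x ≤ v x := by
          have h3 : ((s.erase (ξ, n) : Finset (H × ℕ)) : Set (H × ℕ)) ⊆ F := fun p hp => by
            have hp' := Finset.mem_erase.1 (Finset.mem_coe.1 hp)
            exact (hs hp'.2).resolve_left hp'.1
          calc ∑ p ∈ s.erase (ξ, n), vecWeight p.1 x
              = ∑' p : ((s.erase (ξ, n) : Finset (H × ℕ)) : Set (H × ℕ)), vecWeight p.1.1 x :=
                (Finset.tsum_subtype' _ fun p : H × ℕ => vecWeight p.1 x).symm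
            _ ≤ v x := ENNReal.tsum_mono_subtype (fun p : H × ℕ => vecWeight p.1 x) h3
        calc ∑ p ∈ s, vecWeight p.1 x
            ≤ ∑ p ∈ insert (ξ, n) (s.erase (ξ, n)), vecWeight p.1 x :=
              Finset.sum_le_sum_of_subset (Finset.insert_erase_subset _ _)
          _ = vecWeight ξ x + ∑ p ∈ s.erase (ξ, n), vecWeight p.1 x :=
              Finset.sum_insert (Finset.notMem_erase _ _)
          _ ≤ (φ x - v x) + v x := add_le_add (hle x hx) h2
          _ = φ x := tsub_add_cancel_of_le (hvle x hx)
    exact hn (hF.le_of_ge hmem (Set.subset_insert _ _) (Set.mem_insert _ _))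
  have heq : ∀ x ∈ posCone N, φ x = v x := fun x hx => by
    refine le_antisymm (tsub_eq_zero_iff_le.1 (le_antisymm ?_ zero_le)) (hvle x hx)
    exact hψ.le_of_le_one NormalOn.zero (fun z hz hz1 =>
      (hψ.mono hz posCone.one_mem hz1).trans hψ0.le) hx
  -- The sum at `1` is finite and all its terms are positive.
  have hcount : Countable F := by
    have h2 : v 1 ≠ ∞ := ne_top_of_le_ne_top h1 (hvle 1 posCone.one_mem)
    have h3 := Summable.countable_support_ennreal h2
    have h4 : (Function.support fun p : F => vecWeight p.1.1 1) = Set.univ := by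
      refine Set.eq_univ_of_forall fun p => ?_
      rw [Function.mem_support, vecWeight_one, Ne, ENNReal.ofReal_eq_zero, not_le]
      have := hF0 p.1 p.2
      positivity
    rw [h4] at h3
    exact Set.countable_univ_iff.1 h3
  obtain ⟨e, he⟩ := hcount.exists_injective_nat
  let ζ : ℕ → H := Function.extend e (fun p : F => p.1.1) 0
  have hζ : ∀ x, ∑' n, vecWeight (ζ n) x = v x := by
    intro x
    have h2 : ∀ n, n ∉ Set.range e → vecWeight (ζ n) x = 0 := fun n hn => by
      have : ζ n = 0 := Function.extend_apply' _ _ _ hn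
      simp [this, vecWeight, quad]
    rw [← he.tsum_eq (f := fun n => vecWeight (ζ n) x) (fun n hn => by
      by_contra hcon
      exact hn (h2 n hcon))]
    exact tsum_congr fun p => by rw [show ζ (e p) = p.1.1 from he.extend_apply _ _ _]
  have hmem : Memℓp ζ 2 := by
    refine memℓp_gen ?_
    have h2 : ∑' n, vecWeight (ζ n) 1 ≠ ∞ := by
      rw [hζ, ← heq 1 posCone.one_mem]
      exact h1
    have h3 := ENNReal.summable_toReal h2
    refine h3.congr fun n => ?_
    rw [vecWeight_one, ENNReal.toReal_ofReal (by positivity)]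
    simp
  exact ⟨⟨ζ, hmem⟩, fun x hx => by rw [heq x hx, ← hζ]⟩

end

/-! ### Amplification to `ℓ²(ℕ, H)` and weak* continuous functionals. -/

section

variable {N : VonNeumannAlgebra H} {φ : (H →L[ℂ] H) → ℝ≥0∞}

/-- The amplification of an operator to `ℓ²(ℕ, H)`. -/
def amp (x : H →L[ℂ] H) : lp (fun _ : ℕ => H) 2 →L[ℂ] lp (fun _ : ℕ => H) 2 :=
  lp.mapCLM 2 (fun _ => x) (norm_nonneg x) fun _ => le_rfl

@[simp]
theorem amp_apply (x : H →L[ℂ] H) (ζ : lp (fun _ : ℕ => H) 2) (n : ℕ) :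
    amp x ζ n = x (ζ n) := rfl

theorem amp_add (x y : H →L[ℂ] H) (ζ : lp (fun _ : ℕ => H) 2) :
    amp (x + y) ζ = amp x ζ + amp y ζ := by
  ext n; simp

theorem amp_smul (c : ℂ) (x : H →L[ℂ] H) (ζ : lp (fun _ : ℕ => H) 2) :
    amp (c • x) ζ = c • amp x ζ := by
  ext n; simp

theorem amp_mul (x y : H →L[ℂ] H) (ζ : lp (fun _ : ℕ => H) 2) :
    amp (x * y) ζ = amp x (amp y ζ) := by
  ext n; simp

/-- The functional `x ↦ ∑ₙ ⟪ξₙ, x ηₙ⟫`. -/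
def normalForm (ξ η : lp (fun _ : ℕ => H) 2) : (H →L[ℂ] H) →ₗ[ℂ] ℂ where
  toFun x := ⟪ξ, amp x η⟫_ℂ
  map_add' x y := by rw [amp_add, inner_add_right]
  map_smul' c x := by rw [amp_smul, inner_smul_right]; rfl

theorem normalForm_apply (ξ η : lp (fun _ : ℕ => H) 2) (x : H →L[ℂ] H) :
    normalForm ξ η x = ⟪ξ, amp x η⟫_ℂ := rfl

theorem normalForm_eq_tsum (ξ η : lp (fun _ : ℕ => H) 2) (x : H →L[ℂ] H) :
    normalForm ξ η x = ∑' n, ⟪ξ n, x (η n)⟫_ℂ := rfl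

theorem inner_amp_left (x : H →L[ℂ] H) (ξ η : lp (fun _ : ℕ => H) 2) :
    ⟪amp (star x) ξ, η⟫_ℂ = ⟪ξ, amp x η⟫_ℂ := by
  rw [lp.inner_eq_tsum, lp.inner_eq_tsum]
  refine tsum_congr fun n => ?_
  simp [ContinuousLinearMap.star_eq_adjoint, ContinuousLinearMap.adjoint_inner_left]

theorem normalForm_mul_left (ξ η : lp (fun _ : ℕ => H) 2) (y x : H →L[ℂ] H) :
    normalForm ξ η (y * x) = normalForm (amp (star y) ξ) η x := by
  rw [normalForm_apply, normalForm_apply, amp_mul, inner_amp_left]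

theorem normalForm_mul_right (ξ η : lp (fun _ : ℕ => H) 2) (x y : H →L[ℂ] H) :
    normalForm ξ η (x * y) = normalForm ξ (amp y η) x := by
  rw [normalForm_apply, normalForm_apply, amp_mul]

theorem continuous_normalForm (ξ η : lp (fun _ : ℕ => H) 2) :
    Continuous[weakStarTopology H, inferInstance] (normalForm ξ η) :=
  continuous_iInf_dom (i := ξ) (continuous_iInf_dom (i := η) continuous_induced_dom)

theorem normalForm_self_of_nonneg (ζ : lp (fun _ : ℕ => H) 2) {x : H →L[ℂ] H} (hx : 0 ≤ x) :
    normalForm ζ ζ x = ((∑' n, vecWeight (ζ n) x).toReal : ℂ) := by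
  rw [normalForm_eq_tsum, ENNReal.tsum_toReal_eq fun n => vecWeight_ne_top _ _, Complex.ofReal_tsum]
  refine tsum_congr fun n => ?_
  rw [inner_eq_quad hx, vecWeight, ENNReal.toReal_ofReal (quad_nonneg hx _)]

theorem tsum_vecWeight_ne_top (ζ : lp (fun _ : ℕ => H) 2) :
    ∑' n, vecWeight (ζ n) (1 : H →L[ℂ] H) ≠ ∞ := by
  have h := lp.summable_inner (𝕜 := ℂ) ζ ζ
  have h2 : Summable fun n => ‖ζ n‖ ^ 2 := by
    refine (Complex.hasSum_re h.hasSum).summable.congr fun n => ?_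
    rw [inner_self_eq_norm_sq_to_K]
    norm_cast
  simp only [vecWeight_one]
  rw [← ENNReal.ofReal_tsum_of_nonneg (fun n => by positivity) h2]
  exact ENNReal.ofReal_ne_top

theorem normalForm_polarization (ξ η : lp (fun _ : ℕ => H) 2) (x : H →L[ℂ] H) :
    normalForm ξ η x = (1 / 4 : ℂ) * (normalForm (η + ξ) (η + ξ) x
      - normalForm (η - ξ) (η - ξ) x
      + Complex.I * normalForm (η + Complex.I • ξ) (η + Complex.I • ξ) x
      - Complex.I * normalForm (η - Complex.I • ξ) (η - Complex.I • ξ) x) := by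
  simp only [normalForm_apply, map_add, map_sub, map_smul, inner_add_left, inner_add_right,
    inner_sub_left, inner_sub_right, inner_smul_left, inner_smul_right, Complex.conj_I]
  linear_combination (-1 / 2 * ⟪η, amp x ξ⟫_ℂ + 1 / 2 * ⟪ξ, amp x η⟫_ℂ) * Complex.I_mul_I

/-- A finite normal weight extends to a linear functional given by a square summable sequence. -/
theorem exists_normalForm (hN : ∀ x ∈ N, ∀ y ∈ N, x * y = y * x) (hφ : NormalOn N φ)
    (h1 : φ 1 ≠ ∞) :
    ∃ ζ : lp (fun _ : ℕ => H) 2, ∀ x ∈ posCone N, normalForm ζ ζ x = ((φ x).toReal : ℂ) := by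
  obtain ⟨ζ, hζ⟩ := exists_eq_tsum_vecWeight hN hφ h1
  exact ⟨ζ, fun x hx => by rw [normalForm_self_of_nonneg ζ hx.2, hζ x hx]⟩

/-- Linear maps that agree on the positive cone agree. -/
theorem linear_ext_on {V : Type*} [AddCommGroup V] [Module ℂ V] {f g : (H →L[ℂ] H) →ₗ[ℂ] V}
    (h : ∀ x ∈ posCone N, f x = g x) {x : H →L[ℂ] H} (hx : x ∈ N) : f x = g x := by
  obtain ⟨p, hp, rfl⟩ := exists_posCone_decomp hx
  simp only [map_sum, map_smul]
  exact Finset.sum_congr rfl fun k _ => by rw [h _ (hp k)]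

end

/-! ### The conditional expectation preserving a normal weight. -/

section

variable {M D : VonNeumannAlgebra H} {ρ : (H →L[ℂ] H) → ℝ≥0∞}

theorem linearMap_ext_of_nonneg {V : Type*} [AddCommGroup V] [Module ℂ V]
    {f g : M.toStarSubalgebra →ₗ[ℂ] V}
    (h : ∀ x : M.toStarSubalgebra, 0 ≤ (x : H →L[ℂ] H) → f x = g x) : f = g := by
  ext x
  obtain ⟨p, hp, hx⟩ := exists_posCone_decomp (N := M) x.2
  have hx' : x = ∑ k : Fin 4, Complex.I ^ (k : ℕ) • (⟨p k, (hp k).1⟩ : M.toStarSubalgebra) := by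
    apply Subtype.ext
    rw [hx]
    simp
  rw [hx']
  simp only [map_sum, map_smul]
  exact Finset.sum_congr rfl fun k _ => by rw [h _ (hp k).2]

theorem posCone_mono (hDM : (D : Set (H →L[ℂ] H)) ⊆ M) : posCone D ⊆ posCone M :=
  fun _ hx => ⟨hDM hx.1, hx.2⟩

/-- The positive contractions of finite weight form a directed set with supremum `1`. -/
theorem isLUB_one_of_semifinite (hD : ∀ x ∈ D, ∀ y ∈ D, x * y = y * x) (hρ : NormalOn D ρ)
    (hs : ∀ k ∈ D, (∀ d ∈ posCone D, ρ d ≠ ∞ → d * k = 0) → k = 0) :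
    ∃ W ⊆ posCone D, (∀ w ∈ W, ρ w ≠ ∞) ∧ W.Nonempty ∧ DirectedOn (· ≤ ·) W ∧ IsLUB W 1 := by
  let W : Set (H →L[ℂ] H) := {w | (w ∈ posCone D ∧ w ≤ 1) ∧ ρ w ≠ ∞}
  have hsoft : ∀ a ∈ W, ∀ b ∈ W, a + (1 - a) * b ∈ W := by
    rintro a ⟨⟨ha, ha1⟩, ha0⟩ b ⟨⟨hb, hb1⟩, hb0⟩
    obtain ⟨h2, h3, -, -, h4⟩ := softSup hD ha hb ha1 hb1
    refine ⟨⟨h2, h3⟩, ne_top_of_le_ne_top ?_ (hρ.mono h2 (posCone.add_mem ha hb) h4)⟩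
    rw [hρ.add a ha b hb]
    exact ENNReal.add_ne_top.2 ⟨ha0, hb0⟩
  have hWne : W.Nonempty := ⟨0, ⟨posCone.zero_mem, zero_le_one⟩, by rw [hρ.map_zero]; simp⟩
  have hWD : W ⊆ posCone D := fun w hw => hw.1.1
  obtain ⟨hWd, s, hs', hlub⟩ := exists_greatest_of_softSup hD (S := W) (fun s hs => hs.1) hWne hsoft
  refine ⟨W, hWD, fun w hw => hw.2, hWne, hWd, ?_⟩
  have hs1 : s ≤ 1 := hlub.2 fun w hw => hw.1.2
  have hsc := posCone.sub_mem posCone.one_mem hs' hs1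
  suffices h : (1 - s : H →L[ℂ] H) = 0 by
    rw [sub_eq_zero] at h
    rwa [h]
  refine hs _ hsc.1 fun d hd hdfin => ?_
  obtain ⟨t, e, he, he1, ht, rfl⟩ := exists_smul_le_one hd
  have hefin : ρ e ≠ ∞ := fun h => hdfin (by
    rw [hρ.smul t e he, h, ENNReal.mul_top (by exact_mod_cast ht.ne')])
  have he' := posCone.sub_mem posCone.one_mem he he1
  have h1 := isLUB_mul_left hD hWD hWne hWd hs' hlub he'
  -- For `w ∈ W` also `e + (1 - e) w ∈ W`, so it is at most `s`; taking the supremum over `w` gives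
  -- `e (1 - s) ≤ 0`.
  have h2 : (1 - e) * s ≤ s - e := by
    refine h1.2 ?_
    rintro _ ⟨w, hw, rfl⟩
    rw [le_sub_iff_add_le, add_comm]
    exact hlub.1 (hsoft e ⟨⟨he, he1⟩, hefin⟩ w hw)
  have h3 : e * (1 - s) ≤ 0 := by
    rw [← sub_nonneg] at h2 ⊢
    convert h2 using 1
    noncomm_ring
  rw [smul_mul_assoc, le_antisymm h3 (posCone.mul_mem hD he hsc).2, smul_zero]

/-- `ζ` represents the finite normal functional `ρ (d ·)` on `M`. -/
def Represents (M : VonNeumannAlgebra H) (ρ : (H →L[ℂ] H) → ℝ≥0∞) (d : H →L[ℂ] H)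
    (ζ : lp (fun _ : ℕ => H) 2) : Prop :=
  ∀ x ∈ posCone M, normalForm ζ ζ x = ((ρ (d * x)).toReal : ℂ)

theorem NormalOn.mul_ne_top (hM : ∀ x ∈ M, ∀ y ∈ M, x * y = y * x) (hρ : NormalOn M ρ)
    {d x : H →L[ℂ] H} (hd : d ∈ posCone M) (hfin : ρ d ≠ ∞) (hx : x ∈ posCone M) :
    ρ (d * x) ≠ ∞ :=
  (hρ.mul_left hM hd).ne_top (by simpa using hfin) hx

theorem exists_represents (hM : ∀ x ∈ M, ∀ y ∈ M, x * y = y * x) (hρ : NormalOn M ρ)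
    {d : H →L[ℂ] H} (hd : d ∈ posCone M) (hfin : ρ d ≠ ∞) : ∃ ζ, Represents M ρ d ζ :=
  exists_normalForm hM (hρ.mul_left hM hd) (by simpa using hfin)

/-- Moves a factor from the argument into the density, independently of the chosen vectors. It
upgrades identities for all `ρ (d ·)` to identities multiplied by elements of `D`. -/
theorem Represents.mul {d e : H →L[ℂ] H} {ζ ζ' : lp (fun _ : ℕ => H) 2}
    (hM : ∀ x ∈ M, ∀ y ∈ M, x * y = y * x) (he : e ∈ posCone M)
    (h : Represents M ρ d ζ) (h' : Represents M ρ (d * e) ζ') {x : H →L[ℂ] H} (hx : x ∈ M) :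
    normalForm ζ ζ (e * x) = normalForm ζ' ζ' x := by
  refine linear_ext_on (N := M) (f := (normalForm ζ ζ).comp (LinearMap.mulLeft ℂ e))
    (fun y hy => ?_) hx
  rw [LinearMap.comp_apply, LinearMap.mulLeft_apply, h _ (posCone.mul_mem hM he hy), h' _ hy,
    mul_assoc]

/-- The functionals `ρ (d ·)` with `d ∈ D` of finite weight separate the points of `D`. -/
theorem eq_zero_of_represents (hM : ∀ x ∈ M, ∀ y ∈ M, x * y = y * x)
    (hDM : (D : Set (H →L[ℂ] H)) ⊆ M) (hρ : NormalOn M ρ)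
    (hf : ∀ x ∈ posCone D, ρ x = 0 → x = 0)
    (hs : ∀ k ∈ D, (∀ d ∈ posCone D, ρ d ≠ ∞ → d * k = 0) → k = 0)
    {c : H →L[ℂ] H} (hc : c ∈ D)
    (h : ∀ d ∈ posCone D, ρ d ≠ ∞ → ∃ ζ, Represents M ρ d ζ ∧ normalForm ζ ζ c = 0) : c = 0 := by
  have hPP := posCone_mono hDM
  have hD : ∀ x ∈ D, ∀ y ∈ D, x * y = y * x := fun x hx y hy => hM x (hDM hx) y (hDM hy)
  have hccD : star c * c ∈ posCone D := ⟨mul_mem (star_mem hc) hc, star_mul_self_nonneg c⟩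
  suffices h0 : star c * c = 0 from CStarRing.star_mul_self_eq_zero_iff _ |>.1 h0
  refine hs _ hccD.1 fun d hd hdfin => hf _ (posCone.mul_mem hD hd hccD) ?_
  obtain ⟨ζ, hζ, -⟩ := h d hd hdfin
  -- The hypothesis at `d e` instead of `d` extends the vanishing from `c` to `D c`. At `y = c*` it
  -- reads `ρ (d c* c) = 0`, so faithfulness gives `d c* c = 0`.
  have key : ∀ y ∈ D, normalForm ζ ζ (y * c) = 0 := by
    intro y hy
    refine linear_ext_on (N := D) (f := (normalForm ζ ζ).comp (LinearMap.mulRight ℂ c)) (g := 0)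
      (fun e he => ?_) hy
    have hdefin := hρ.mul_ne_top hM (hPP hd) hdfin (hPP he)
    obtain ⟨ζ', hζ', h0⟩ := h (d * e) (posCone.mul_mem hD hd he) hdefin
    rw [LinearMap.comp_apply, LinearMap.mulRight_apply, hζ.mul hM (hPP he) hζ' (hDM hc), h0]
    rfl
  have h1 := key (star c) (star_mem hc)
  rw [hζ _ (hPP hccD)] at h1
  have h2 : (ρ (d * (star c * c))).toReal = 0 := by exact_mod_cast h1
  exact ((ENNReal.toReal_eq_zero_iff _).1 h2).resolve_right
    (hρ.mul_ne_top hM (hPP hd) hdfin (hPP hccD))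

/-- Polarization: weak* continuity of `x ↦ ⟪ξ, x η⟫`-type functionals of a map only has to be
tested on the diagonal. -/
theorem continuous_weakStarTopologyOn {S : Set (H →L[ℂ] H)} {E : S → H →L[ℂ] H}
    (h : ∀ ζ : lp (fun _ : ℕ => H) 2, ∃ ζ' : lp (fun _ : ℕ => H) 2, ∀ x : S,
      normalForm ζ ζ (E x) = normalForm ζ' ζ' (x : H →L[ℂ] H)) :
    Continuous[weakStarTopologyOn S, weakStarTopology H] E := by
  choose Z hZ using h
  have hc : ∀ ζ : lp (fun _ : ℕ => H) 2,
      Continuous[weakStarTopologyOn S, inferInstance] fun x => normalForm ζ ζ (E x) := by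
    intro ζ
    simp only [hZ]
    let _ := weakStarTopology H
    exact (continuous_normalForm _ _).comp continuous_induced_dom
  refine continuous_iInf_rng.2 fun ξ => continuous_iInf_rng.2 fun η => continuous_induced_rng.2 ?_
  have h1 : (fun x : H →L[ℂ] H => ∑' n, ⟪ξ n, x (η n)⟫_ℂ) ∘ E = fun x => normalForm ξ η (E x) := rfl
  rw [h1]
  simp only [normalForm_polarization ξ η]
  let _ := weakStarTopologyOn S
  exact continuous_const.mul ((((hc _).sub (hc _)).add (continuous_const.mul (hc _))).sub
    (continuous_const.mul (hc _)))

/-- Existence of the conditional expectation of an element. -/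
theorem exists_condExp_apply (hM : ∀ x ∈ M, ∀ y ∈ M, x * y = y * x)
    (hDM : (D : Set (H →L[ℂ] H)) ⊆ M) (hρ : NormalOn M ρ) :
    (∀ x ∈ posCone M, ∃ c ∈ posCone D, ∀ d ∈ posCone D, ρ d ≠ ∞ → ρ (d * x) = ρ (d * c)) ∧
    ∀ x ∈ M, ∃ c ∈ D, ∀ d ∈ posCone D, ρ d ≠ ∞ → ∀ ζ, Represents M ρ d ζ →
      normalForm ζ ζ x = normalForm ζ ζ c := by
  have hPP := posCone_mono hDM
  have hD : ∀ x ∈ D, ∀ y ∈ D, x * y = y * x := fun x hx y hy => hM x (hDM hx) y (hDM hy)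
  have hpos : ∀ x ∈ posCone M, ∃ c ∈ posCone D, ∀ d ∈ posCone D, ρ d ≠ ∞ →
      ρ (d * x) = ρ (d * c) := by
    intro x hx
    obtain ⟨t, y, hy, hy1, -, rfl⟩ := exists_smul_le_one hx
    -- The weight `d ↦ ρ (y d)` on `D` is dominated by `ρ`, as `y ≤ 1`.
    obtain ⟨c, hc, -, hceq⟩ := exists_density hD
      ((hρ.mul_left hM hy).of_subset hDM) (hρ.of_subset hDM) fun d hd =>
        hρ.mono (posCone.mul_mem hM hy (hPP hd)) (hPP hd) (mul_le_of_le_one hM (hPP hd) hy hy1)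
    refine ⟨((t : ℝ) : ℂ) • c, posCone.smul_mem t.coe_nonneg hc, fun d hd hdfin => ?_⟩
    rw [mul_smul_comm, mul_smul_comm, hρ.smul t _ (posCone.mul_mem hM (hPP hd) hy),
      hρ.smul t _ (hPP (posCone.mul_mem hD hd hc)), hM d (hDM hd.1) y hy.1, hceq d hd hdfin,
      hD c hc.1 d hd.1]
  refine ⟨hpos, fun x hx => ?_⟩
  obtain ⟨p, hp, rfl⟩ := exists_posCone_decomp hx
  choose c hc hceq using fun k => hpos (p k) (hp k)
  refine ⟨∑ k : Fin 4, Complex.I ^ (k : ℕ) • c k,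
    sum_mem fun k _ => smul_mem_vN _ (hc k).1, fun d hd hdfin ζ hζ => ?_⟩
  simp only [map_sum, map_smul]
  refine Finset.sum_congr rfl fun k _ => ?_
  rw [hζ _ (hp k), hζ _ (hPP (hc k)), hceq k d hd hdfin]

/-- A normal weight on a commutative von Neumann algebra `M` that is faithful and semifinite on
the subalgebra `D` is preserved by a normal conditional expectation of `M` onto `D`, which is
determined by the functionals `ρ (d ·)`. -/
theorem exists_isNormalCondExp (hM : ∀ x ∈ M, ∀ y ∈ M, x * y = y * x)
    (hDM : (D : Set (H →L[ℂ] H)) ⊆ M) (hρ : NormalOn M ρ)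
    (hf : ∀ x ∈ posCone D, ρ x = 0 → x = 0)
    (hs : ∀ k ∈ D, (∀ d ∈ posCone D, ρ d ≠ ∞ → d * k = 0) → k = 0) :
    ∃ Ψ : M.toStarSubalgebra →ₗ[ℂ] D.toStarSubalgebra, IsNormalCondExp Ψ ∧
      (∀ x : M.toStarSubalgebra, 0 ≤ (x : H →L[ℂ] H) → ρ (Ψ x) = ρ x) ∧
      ∀ (x : M.toStarSubalgebra) (c : D.toStarSubalgebra),
        (∀ d ∈ posCone D, ρ d ≠ ∞ → ∀ ζ, Represents M ρ d ζ →
          normalForm ζ ζ (x : H →L[ℂ] H) = normalForm ζ ζ (c : H →L[ℂ] H)) → Ψ x = c := by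
  have hPP := posCone_mono hDM
  have hD : ∀ x ∈ D, ∀ y ∈ D, x * y = y * x := fun x hx y hy => hM x (hDM hx) y (hDM hy)
  obtain ⟨hpos, hall⟩ := exists_condExp_apply hM hDM hρ
  choose E hE hEeq using fun x : M.toStarSubalgebra => hall x x.2
  -- The choice of `E x` is forced because the functionals separate `D`. Linearity, positivity, the
  -- module property and normality are all deduced from this.
  have huniq : ∀ (x : M.toStarSubalgebra), ∀ c ∈ D, (∀ d ∈ posCone D, ρ d ≠ ∞ → ∀ ζ,
      Represents M ρ d ζ → normalForm ζ ζ (x : H →L[ℂ] H) = normalForm ζ ζ c) → E x = c := by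
    intro x c hc h
    rw [← sub_eq_zero]
    refine eq_zero_of_represents hM hDM hρ hf hs (sub_mem (hE x) hc) fun d hd hdfin => ?_
    obtain ⟨ζ, hζ⟩ := exists_represents hM hρ (hPP hd) hdfin
    exact ⟨ζ, hζ, by rw [map_sub, ← hEeq x d hd hdfin ζ hζ, h d hd hdfin ζ hζ, sub_self]⟩
  let Ψ : M.toStarSubalgebra →ₗ[ℂ] D.toStarSubalgebra :=
    { toFun := fun x => ⟨E x, hE x⟩
      map_add' := fun x y => Subtype.ext <| huniq _ _ (add_mem (hE x) (hE y))
        fun d hd hdfin ζ hζ => by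
          change normalForm ζ ζ ((x : H →L[ℂ] H) + y) = normalForm ζ ζ (E x + E y)
          rw [map_add, map_add, hEeq x d hd hdfin ζ hζ, hEeq y d hd hdfin ζ hζ]
      map_smul' := fun c x => Subtype.ext <| huniq _ _ (smul_mem_vN c (hE x))
        fun d hd hdfin ζ hζ => by
          change normalForm ζ ζ (c • (x : H →L[ℂ] H)) = normalForm ζ ζ (c • E x)
          rw [map_smul, map_smul, hEeq x d hd hdfin ζ hζ] }
  have hEpos : ∀ x : M.toStarSubalgebra, 0 ≤ (x : H →L[ℂ] H) → E x ∈ posCone D := by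
    intro x hx
    obtain ⟨c, hc, hceq⟩ := hpos x ⟨x.2, hx⟩
    rw [huniq x c hc.1 fun d hd hdfin ζ hζ => by
      rw [hζ _ ⟨x.2, hx⟩, hζ _ (hPP hc), hceq d hd hdfin]]
    exact hc
  have hEρ : ∀ x : M.toStarSubalgebra, 0 ≤ (x : H →L[ℂ] H) → ∀ d ∈ posCone D, ρ d ≠ ∞ →
      ρ (d * E x) = ρ (d * x) := by
    intro x hx d hd hdfin
    obtain ⟨ζ, hζ⟩ := exists_represents hM hρ (hPP hd) hdfin
    have h1 := hEeq x d hd hdfin ζ hζ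
    rw [hζ _ ⟨x.2, hx⟩, hζ _ (hPP (hEpos x hx))] at h1
    have h2 : (ρ (d * x)).toReal = (ρ (d * E x)).toReal := by exact_mod_cast h1
    exact ((ENNReal.toReal_eq_toReal_iff' (hρ.mul_ne_top hM (hPP hd) hdfin ⟨x.2, hx⟩)
      (hρ.mul_ne_top hM (hPP hd) hdfin (hPP (hEpos x hx)))).1 h2).symm
  have hmono : ∀ x y : M.toStarSubalgebra, (x : H →L[ℂ] H) ≤ y → E x ≤ E y := by
    intro x y hxy
    have h1 : 0 ≤ E (y - x) := (hEpos (y - x) (sub_nonneg.2 hxy)).2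
    have h2 : E (y - x) = E y - E x := congrArg Subtype.val (map_sub Ψ y x)
    rw [h2] at h1
    exact sub_nonneg.1 h1
  have hmem : ∀ x : M.toStarSubalgebra, (x : H →L[ℂ] H) ∈ D → E x = x := fun x hx =>
    huniq x x hx fun d hd hdfin ζ hζ => rfl
  have hlub : ∀ S ⊆ posCone M, S.Nonempty → DirectedOn (· ≤ ·) S → ∀ x ∈ posCone M, IsLUB S x →
      ∀ G : (H →L[ℂ] H) → (H →L[ℂ] H), (∀ z : M.toStarSubalgebra, G z = E z) →
      G '' S ⊆ posCone D ∧ DirectedOn (· ≤ ·) (G '' S) ∧ IsLUB (G '' S) (G x) := by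
    intro S hS hne hd x hx hxlub G hG
    have hsub : G '' S ⊆ posCone D := by
      rintro _ ⟨s, hs', rfl⟩
      rw [hG ⟨s, (hS hs').1⟩]
      exact hEpos _ (hS hs').2
    have hle : ∀ s t, s ∈ posCone M → t ∈ posCone M → s ≤ t → G s ≤ G t := fun s t h1 h2 hst => by
      rw [hG ⟨s, h1.1⟩, hG ⟨t, h2.1⟩]
      exact hmono _ _ hst
    have hdir : DirectedOn (· ≤ ·) (G '' S) := by
      rintro _ ⟨s, hs', rfl⟩ _ ⟨t, ht, rfl⟩
      obtain ⟨u, hu, hsu, htu⟩ := hd s hs' t ht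
      exact ⟨_, ⟨u, hu, rfl⟩, hle s u (hS hs') (hS hu) hsu, hle t u (hS ht) (hS hu) htu⟩
    obtain ⟨c, hc, hclub⟩ := exists_isLUB hsub (hne.image G) hdir (b := G x) (by
      rintro _ ⟨s, hs', rfl⟩
      exact hle s x (hS hs') hx (hxlub.1 hs'))
    refine ⟨hsub, hdir, ?_⟩
    -- The supremum `c` of the images is `E x`, since `ρ (d c) = sup ρ (d E s) = sup ρ (d s) = ρ (d
    -- x)`.
    rw [hG ⟨x, hx.1⟩, huniq ⟨x, hx.1⟩ c hc.1 fun d hd' hdfin ζ hζ => ?_]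
    · exact hclub
    · rw [hζ _ hx, hζ _ (hPP hc),
        (hρ.mul_left hM (hPP hd')).sup S hS hne hd x hx hxlub,
        ((hρ.of_subset hDM).mul_left hD hd').sup _ hsub (hne.image G) hdir c hc hclub, iSup_image]
      congr 2
      refine iSup_congr fun s => iSup_congr fun hs' => ?_
      rw [hG ⟨s, (hS hs').1⟩, hEρ ⟨s, (hS hs').1⟩ (hS hs').2 d hd' hdfin]
  have hcont : Continuous[weakStarTopologyOn (M : Set (H →L[ℂ] H)), weakStarTopology H] E := by
    refine continuous_weakStarTopologyOn fun ζ => ?_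
    -- `E` extended by zero off `M`. Composing a vector functional with `E` gives a finite normal
    -- weight on `M`, hence again a vector functional; this is weak* continuity.
    let G : (H →L[ℂ] H) → (H →L[ℂ] H) := Function.extend Subtype.val E 0
    have hG : ∀ z : M.toStarSubalgebra, G z = E z := fun z =>
      Subtype.val_injective.extend_apply _ _ _
    have hGD : ∀ z ∈ posCone M, G z ∈ posCone D := fun z hz => by
      rw [hG ⟨z, hz.1⟩]
      exact hEpos _ hz.2
    have hφ : NormalOn D fun x => ∑' n, vecWeight (ζ n) x :=
      NormalOn.tsum fun n => normalOn_vecWeight D (ζ n)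
    have hφG : NormalOn M fun x => ∑' n, vecWeight (ζ n) (G x) := by
      refine ⟨fun x hx y hy => ?_, fun t x hx => ?_, fun S hS hne hd x hx hxlub => ?_⟩
      · have h1 : G (x + y) = G x + G y := by
          rw [hG ⟨x, hx.1⟩, hG ⟨y, hy.1⟩, hG ⟨x + y, add_mem hx.1 hy.1⟩]
          exact congrArg Subtype.val (map_add Ψ ⟨x, hx.1⟩ ⟨y, hy.1⟩)
        rw [h1]
        exact hφ.add _ (hGD x hx) _ (hGD y hy)
      · have h1 : G (((t : ℝ) : ℂ) • x) = ((t : ℝ) : ℂ) • G x := by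
          rw [hG ⟨x, hx.1⟩, hG ⟨_, smul_mem_vN _ hx.1⟩]
          exact congrArg Subtype.val (map_smul Ψ ((t : ℝ) : ℂ) ⟨x, hx.1⟩)
        rw [h1]
        exact hφ.smul t _ (hGD x hx)
      · obtain ⟨h1, h2, h3⟩ := hlub S hS hne hd x hx hxlub G hG
        have := hφ.sup _ h1 (hne.image G) h2 _ (hGD x hx) h3
        rwa [iSup_image] at this
    have hG1 : G 1 = 1 := by
      exact (hG 1).trans (hmem 1 (one_mem D))
    obtain ⟨ζ', hζ'⟩ := exists_normalForm hM hφG (by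
      simp only [hG1]
      exact tsum_vecWeight_ne_top ζ)
    refine ⟨ζ', fun x => ?_⟩
    have hlin : (normalForm ζ ζ).comp (D.toStarSubalgebra.toSubalgebra.toSubmodule.subtype.comp Ψ)
        = (normalForm ζ' ζ').comp M.toStarSubalgebra.toSubalgebra.toSubmodule.subtype := by
      refine linearMap_ext_of_nonneg fun z hz => ?_
      change normalForm ζ ζ (E z) = normalForm ζ' ζ' (z : H →L[ℂ] H)
      rw [hζ' _ ⟨z.2, hz⟩, hG z, normalForm_self_of_nonneg ζ (hEpos z hz).2]
    exact congrArg (fun L => L x) hlin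
  refine ⟨Ψ, ⟨?_, fun x hx => (hEpos x hx).2, fun x hx => hmem x hx, ?_, ?_⟩, ?_,
    fun x c h => Subtype.ext (huniq x c c.2 h)⟩
  · exact Subtype.ext (hmem 1 (one_mem D))
  · intro d e x y hy
    refine huniq _ _ (mul_mem (mul_mem d.2 (hE x)) e.2) fun d₀ hd₀ hd₀fin ζ hζ => ?_
    -- For `k` positive in `D`, multiplying the argument by `k` replaces `d₀` by `d₀ k`, where the
    -- defining identity of `E x` applies; the general `g` follows by linearity.
    have key : ∀ g ∈ D, normalForm ζ ζ (g * x) = normalForm ζ ζ (g * E x) := by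
      intro g hg
      refine linear_ext_on (N := D)
        (f := (normalForm ζ ζ).comp (LinearMap.mulRight ℂ (x : H →L[ℂ] H)))
        (g := (normalForm ζ ζ).comp (LinearMap.mulRight ℂ (E x))) (fun k hk => ?_) hg
      have hfin := hρ.mul_ne_top hM (hPP hd₀) hd₀fin (hPP hk)
      obtain ⟨ζ', hζ'⟩ := exists_represents hM hρ (posCone.mul_mem hM (hPP hd₀) (hPP hk)) hfin
      rw [LinearMap.comp_apply, LinearMap.mulRight_apply, LinearMap.comp_apply,
        LinearMap.mulRight_apply, hζ.mul hM (hPP hk) hζ' x.2,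
        hζ.mul hM (hPP hk) hζ' (hDM (hE x)), hEeq x _ (posCone.mul_mem hD hd₀ hk) hfin ζ' hζ']
    rw [hy, mul_assoc, hM x x.2 e (hDM e.2), ← mul_assoc, key _ (mul_mem d.2 e.2)]
    change _ = normalForm ζ ζ ((d : H →L[ℂ] H) * E x * e)
    rw [mul_assoc, mul_assoc, hD (E x) (hE x) e e.2]
  · exact continuous_induced_rng.2 hcont
  · intro x hx
    change ρ (E x) = ρ x
    -- `ρ (w E x) = ρ (w x)` is known for `w` of finite weight; such contractions increase to `1`,
    -- and normality gives the value at `x`, possibly `∞`.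
    obtain ⟨W, hWD, hWfin, hWne, hWd, hW⟩ := isLUB_one_of_semifinite hD (hρ.of_subset hDM) hs
    have hsup : ∀ z ∈ posCone M, ρ z = ⨆ w ∈ W, ρ (z * w) := fun z hz => by
      have := (hρ.mul_left hM hz).sup W (hWD.trans hPP) hWne hWd 1 posCone.one_mem hW
      rwa [mul_one] at this
    rw [hsup _ (hPP (hEpos x hx)), hsup _ ⟨x.2, hx⟩]
    refine iSup_congr fun w => iSup_congr fun hw => ?_
    rw [hD _ (hE x) w (hWD hw).1, hM x x.2 w (hDM (hWD hw).1), hEρ x hx w (hWD hw) (hWfin w hw)]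

end

/-! ### Transfer to the structure `Weight`; traces extending `σ ∘ Φ`. -/

section

variable {M N D : VonNeumannAlgebra H}

open Classical in
/-- A weight as a function on all operators, with value zero off the positive cone. -/
def Weight.extend (ω : Weight N) (x : H →L[ℂ] H) : ℝ≥0∞ :=
  if h : x ∈ posCone N then ω ⟨x, h⟩ else 0

theorem Weight.extend_coe (ω : Weight N) (x : posCone N) : ω.extend x = ω x :=
  dif_pos x.2

theorem Weight.extend_of_mem (ω : Weight N) {x : H →L[ℂ] H} (hx : x ∈ posCone N) :
    ω.extend x = ω ⟨x, hx⟩ := dif_pos hx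

theorem Weight.IsNormal.normalOn {ω : Weight N} (hω : ω.IsNormal) : NormalOn N ω.extend := by
  refine ⟨fun x hx y hy => ?_, fun t x hx => ?_, fun S hS hne hd x hx hlub => ?_⟩
  · rw [ω.extend_of_mem hx, ω.extend_of_mem hy, ω.extend_of_mem (posCone.add_mem hx hy)]
    exact ω.map_add _ _ _ rfl
  · rw [ω.extend_of_mem hx, ω.extend_of_mem (posCone.smul_mem t.coe_nonneg hx)]
    exact ω.map_smul _ _ _ rfl
  · rw [ω.extend_of_mem hx, hω (Subtype.val ⁻¹' S) ⟨x, hx⟩]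
    · refine le_antisymm (iSup₂_le fun s hs => ?_) (iSup₂_le fun s hs => ?_)
      · rw [← ω.extend_coe]
        exact le_iSup₂ (f := fun s (_ : s ∈ S) => ω.extend s) s.1 hs
      · rw [ω.extend_of_mem (hS hs)]
        exact le_iSup₂ (f := fun (s : posCone N) (_ : s ∈ Subtype.val ⁻¹' S) => ω s)
          ⟨s, hS hs⟩ hs
    · obtain ⟨s, hs⟩ := hne
      exact ⟨⟨s, hS hs⟩, hs⟩
    · intro a ha b hb
      obtain ⟨c, hc, h1, h2⟩ := hd a ha b hb
      exact ⟨⟨c, hS hc⟩, hc, h1, h2⟩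
    · refine ⟨fun s hs => hlub.1 hs, fun u hu => hlub.2 fun s hs => ?_⟩
      exact hu (a := ⟨s, hS hs⟩) hs

/-- A normal weight given as a function on operators. -/
def NormalOn.toWeight {φ : (H →L[ℂ] H) → ℝ≥0∞} (hφ : NormalOn N φ) : Weight N where
  toFun x := φ x
  map_add x y z h := by rw [h]; exact hφ.add x x.2 y y.2
  map_smul t x z h := by rw [h]; exact hφ.smul t x x.2

/-- A supremum taken within the cone is also one among all operators: the bounded directed set has
an operator supremum lying in the cone, and the two must agree. -/
theorem NormalOn.isNormal_toWeight {φ : (H →L[ℂ] H) → ℝ≥0∞} (hφ : NormalOn N φ) :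
    hφ.toWeight.IsNormal := by
  intro S x hne hd hlub
  have hsub : Subtype.val '' S ⊆ posCone N := by
    rintro _ ⟨s, -, rfl⟩
    exact s.2
  have hd' : DirectedOn (· ≤ ·) (Subtype.val '' S) := by
    rintro _ ⟨s, hs, rfl⟩ _ ⟨t, ht, rfl⟩
    obtain ⟨u, hu, h1, h2⟩ := hd s hs t ht
    exact ⟨u, ⟨u, hu, rfl⟩, h1, h2⟩
  obtain ⟨y, hy, hylub⟩ := exists_isLUB hsub (hne.image _) hd' (b := x) (by
    rintro _ ⟨s, hs, rfl⟩
    exact hlub.1 hs)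
  have hyx : x = ⟨y, hy⟩ := hlub.unique
    ⟨fun s hs => hylub.1 ⟨s, hs, rfl⟩, fun u hu => hylub.2 (by
      rintro _ ⟨s, hs, rfl⟩
      exact hu hs)⟩
  have := hφ.sup _ hsub (hne.image _) hd' y hy hylub
  rw [iSup_image] at this
  rw [hyx]
  exact this

/-- The elements of finite weight of a semifinite weight have no annihilator. -/
theorem Weight.IsSemifinite.eq_zero {σ : Weight D} (hσ : σ.IsSemifinite) {k : H →L[ℂ] H}
    (h : ∀ d ∈ posCone D, σ.extend d ≠ ∞ → d * k = 0) : k = 0 := by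
  have h1 : (1 : H →L[ℂ] H) ∈ @closure _ (weakStarTopology H) σ.squareFinite := hσ (one_mem D)
  have key : ∀ ξ η : lp (fun _ : ℕ => H) 2, normalForm ξ (amp k η) (1 : H →L[ℂ] H) = 0 := by
    intro ξ η
    -- If `ρ (y* y)` is finite then `y* y k = 0`, so `y k = 0`. This is a weak* closed condition on
    -- `y`, and `1` is in the closure.
    have hclosed : IsClosed[weakStarTopology H] {y | normalForm ξ (amp k η) y = 0} := by
      let _ := weakStarTopology H
      exact isClosed_singleton.preimage (continuous_normalForm ξ (amp k η))
    have hsub : σ.squareFinite ⊆ {y | normalForm ξ (amp k η) y = 0} := by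
      rintro y ⟨hy, p, hp, hpfin⟩
      have h2 := h p p.2 (by rw [σ.extend_coe]; exact hpfin.ne)
      have h3 : star (y * k) * (y * k) = 0 := by
        rw [star_mul, mul_assoc, ← mul_assoc (star y), ← hp, h2, mul_zero]
      have h4 : y * k = 0 := (CStarRing.star_mul_self_eq_zero_iff _).1 h3
      rw [Set.mem_ofPred_eq, ← normalForm_mul_right, h4, _root_.map_zero]
    let _ := weakStarTopology H
    exact closure_minimal hsub hclosed h1
  ext η
  -- With all vectors placed in coordinate `0`, the vanishing reads `‖k η‖² = 0`.
  have h2 := key (amp k (lp.single 2 0 η)) (lp.single 2 0 η)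
  rw [normalForm_apply, show amp (1 : H →L[ℂ] H) (amp k (lp.single 2 0 η))
    = amp k (lp.single 2 0 η) from rfl, inner_self_eq_zero] at h2
  have h3 := congrArg (fun f : lp (fun _ : ℕ => H) 2 => f 0) h2
  simpa using h3

/-- For `e` square finite for `σ` and `y ∈ M`, the value `ρ (e* e y* y)` is finite, so `y e` is
square finite for `ρ`. As `1` is a weak* limit of such `e` and multiplication by `y` is weak*
continuous, `y` is a limit of such `y e`. -/
theorem isSemifinite_of_restrict (hM : ∀ x ∈ M, ∀ y ∈ M, x * y = y * x)
    (hDM : (D : Set (H →L[ℂ] H)) ⊆ M) {σ : Weight D} (hσ : σ.IsSemifinite) {ρ : Weight M}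
    (hρ : ρ.IsNormal) (hρσ : ∀ x ∈ posCone D, ρ.extend x = σ.extend x) : ρ.IsSemifinite := by
  intro y hy
  have hcont : Continuous[weakStarTopology H, weakStarTopology H] fun x => y * x := by
    refine continuous_iInf_rng.2 fun ξ => continuous_iInf_rng.2 fun η =>
      continuous_induced_rng.2 ?_
    have h1 : (fun x : H →L[ℂ] H => ∑' n, ⟪ξ n, x (η n)⟫_ℂ) ∘ (fun x => y * x)
        = normalForm (amp (star y) ξ) η := by
      funext x
      exact normalForm_mul_left ξ η y x
    rw [h1]
    exact continuous_normalForm _ _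
  have h1 : (1 : H →L[ℂ] H) ∈ @closure _ (weakStarTopology H) σ.squareFinite := hσ (one_mem D)
  have hsub : (fun x => y * x) '' σ.squareFinite ⊆ ρ.squareFinite := by
    rintro _ ⟨e, ⟨he, p, hp, hpfin⟩, rfl⟩
    have hyy : star y * y ∈ posCone M := ⟨mul_mem (star_mem hy) hy, star_mul_self_nonneg y⟩
    have hpM : (p : H →L[ℂ] H) ∈ posCone M := ⟨hDM p.2.1, p.2.2⟩
    have hmem := posCone.mul_mem hM hpM hyy
    refine ⟨mul_mem hy (hDM he), ⟨_, hmem⟩, ?_, ?_⟩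
    · change (p : H →L[ℂ] H) * (star y * y) = star (y * e) * (y * e)
      rw [hp, star_mul, mul_assoc, hM e (hDM he) _ hyy.1, mul_assoc, mul_assoc]
    · rw [← ρ.extend_of_mem hmem]
      refine (hρ.normalOn.mul_ne_top hM hpM ?_ hyy).lt_top
      rw [hρσ _ p.2, σ.extend_coe]
      exact hpfin.ne
  let _ := weakStarTopology H
  have h2 := image_closure_subset_closure_image hcont ⟨1, h1, rfl⟩
  simp only [mul_one] at h2
  exact closure_mono hsub h2

variable {A : Subalgebra ℂ (H →L[ℂ] H)} {Φ : A →ₐ[ℂ] D.toStarSubalgebra}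

/-- Common end of both claims: `hΦ` says `ρ (d a) = ρ (d Φ(a))`, so `Φ a` satisfies the identity
characterising `E a`. For a competitor `Ψ'`, `ρ (d Ψ'(x)) = ρ (Ψ'(d x)) = ρ (d x)`, so it satisfies
that identity too. -/
theorem existsUniqueExtension_of_represents (hM : ∀ x ∈ M, ∀ y ∈ M, x * y = y * x)
    (hDM : (D : Set (H →L[ℂ] H)) ⊆ M) {ρ : Weight M} (hρ : ρ.IsNormal)
    (hf : ∀ x ∈ posCone D, ρ.extend x = 0 → x = 0)
    (hs : ∀ k ∈ D, (∀ d ∈ posCone D, ρ.extend d ≠ ∞ → d * k = 0) → k = 0)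
    (hΦ : ∀ a : A, ∀ d ∈ posCone D, ρ.extend d ≠ ∞ → ∀ ζ, Represents M ρ.extend d ζ →
      normalForm ζ ζ (a : H →L[ℂ] H) = normalForm ζ ζ (Φ a : H →L[ℂ] H)) :
    ExistsUniqueExtension ρ Φ := by
  have hn := hρ.normalOn
  have hPP := posCone_mono hDM
  obtain ⟨Ψ, hΨ, hpres, huniq⟩ := exists_isNormalCondExp hM hDM hn hf hs
  refine ⟨Ψ, ⟨hΨ, fun x y hxy => ?_, fun a x hx => ?_⟩, fun Ψ' hΨ' hpres' => ?_⟩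
  · rw [← ρ.extend_coe, ← ρ.extend_coe, hxy, hpres ⟨x, x.2.1⟩ x.2.2]
  · exact huniq x (Φ a) fun d hd hdfin ζ hζ => by rw [hx, hΦ a d hd hdfin ζ hζ]
  · refine LinearMap.ext fun x => (huniq x (Ψ' x) fun d hd hdfin ζ hζ => ?_).symm
    have hlin : (normalForm ζ ζ).comp M.toStarSubalgebra.toSubalgebra.toSubmodule.subtype
        = (normalForm ζ ζ).comp
          (D.toStarSubalgebra.toSubalgebra.toSubmodule.subtype.comp Ψ') := by
      refine linearMap_ext_of_nonneg fun z hz => ?_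
      change normalForm ζ ζ (z : H →L[ℂ] H) = normalForm ζ ζ (Ψ' z : H →L[ℂ] H)
      have hzM : (z : H →L[ℂ] H) ∈ posCone M := ⟨z.2, hz⟩
      have hΨz : (Ψ' z : H →L[ℂ] H) ∈ posCone D := ⟨(Ψ' z).2, hΨ'.nonneg z hz⟩
      have hdz := posCone.mul_mem hM (hPP hd) hzM
      have hdΨz := posCone.mul_mem hM (hPP hd) (hPP hΨz)
      rw [hζ _ hzM, hζ _ (hPP hΨz), ρ.extend_of_mem hdz, ρ.extend_of_mem hdΨz]
      rw [hpres' ⟨_, hdz⟩ ⟨_, hdΨz⟩ ?_]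
      have := hΨ'.map_bimodule ⟨d, hd.1⟩ 1 z ⟨_, hdz.1⟩ (by simp)
      simpa using this.symm
    exact congrArg (fun L => L x) hlin

/-- The second part: traces extending `σ ∘ Φ` have a unique normal conditional expectation. -/
theorem existsUniqueExtension_of_extendsComp (hM : ∀ x ∈ M, ∀ y ∈ M, x * y = y * x)
    (hDA : (D : Set (H →L[ℂ] H)) ⊆ (A : Set (H →L[ℂ] H)))
    (hAM : (A : Set (H →L[ℂ] H)) ⊆ (M : Set (H →L[ℂ] H)))
    {σ : Weight D} (hσf : σ.IsFaithful) (hσs : σ.IsSemifinite) (hΦ : IsDCharacter Φ)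
    {ρ : Weight M} (hρ : ρ.IsNormal) (hext : ρ.ExtendsComp σ Φ) : ExistsUniqueExtension ρ Φ := by
  have hDM := hDA.trans hAM
  have hPP := posCone_mono hDM
  have hD : ∀ x ∈ D, ∀ y ∈ D, x * y = y * x := fun x hx y hy => hM x (hDM hx) y (hDM hy)
  have hρσ : ∀ x ∈ posCone D, ρ.extend x = σ.extend x := fun x hx => by
    rw [ρ.extend_of_mem (hPP hx), σ.extend_of_mem hx]
    exact hext.of_nonneg ⟨x, hDA hx.1⟩ _ _ rfl (hΦ.map_of_mem ⟨x, hDA hx.1⟩ hx.1).symm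
  refine existsUniqueExtension_of_represents hM hDM hρ (fun x hx h0 => ?_) (fun k _ h => ?_)
    fun a d hd hdfin ζ hζ => ?_
  · rw [hρσ x hx, σ.extend_of_mem hx] at h0
    exact hσf _ h0
  · exact hσs.eq_zero fun d hd hdfin => h d hd (by rwa [hρσ d hd])
  · let dA : A := ⟨d, hDA hd.1⟩
    have hΦd : (Φ (dA * a) : H →L[ℂ] H) = d * Φ a := by
      rw [map_mul]
      exact congrArg (· * (Φ a : H →L[ℂ] H)) (hΦ.map_of_mem dA hd.1)
    have hn := hρ.normalOn
    -- Multiplying by `d` brings `a` and `Φ a` into the domains of the linear extensions: decompose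
    -- each into positive parts and multiply these by `d`.
    refine hext.of_hasValue (dA * a) _ _ ?_ ?_
    · obtain ⟨p, hp, hpa⟩ := exists_posCone_decomp (N := M) (hAM a.2)
      refine ⟨fun k => ⟨d * p k, posCone.mul_mem hM (hPP hd) (hp k)⟩, fun k => ?_, ?_, ?_⟩
      · rw [← ρ.extend_of_mem]
        exact hn.mul_ne_top hM (hPP hd) hdfin (hp k)
      · change d * (a : H →L[ℂ] H) = _
        rw [hpa, Finset.mul_sum]
        simp only [mul_smul_comm]
      · rw [hpa]
        simp only [map_sum, map_smul, smul_eq_mul]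
        refine Finset.sum_congr rfl fun k _ => ?_
        rw [hζ _ (hp k), ρ.extend_of_mem (posCone.mul_mem hM (hPP hd) (hp k))]
    · obtain ⟨p, hp, hpa⟩ := exists_posCone_decomp (N := D) (Φ a).2
      refine ⟨fun k => ⟨d * p k, posCone.mul_mem hD hd (hp k)⟩, fun k => ?_, ?_, ?_⟩
      · rw [← σ.extend_of_mem, ← hρσ _ (posCone.mul_mem hD hd (hp k))]
        exact hn.mul_ne_top hM (hPP hd) hdfin (hPP (hp k))
      · rw [hΦd, hpa, Finset.mul_sum]
        simp only [mul_smul_comm]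
      · rw [hpa]
        simp only [map_sum, map_smul, smul_eq_mul]
        refine Finset.sum_congr rfl fun k _ => ?_
        rw [hζ _ (hPP (hp k)), hρσ _ (posCone.mul_mem hD hd (hp k)),
          σ.extend_of_mem (posCone.mul_mem hD hd (hp k))]

/-- If a weight on `M` restricts to `σ` and has a conditional expectation extending `Φ`, then it
extends `σ ∘ Φ`. -/
theorem extendsComp_of_existsUniqueExtension (hDM : (D : Set (H →L[ℂ] H)) ⊆ M)
    (hAM : (A : Set (H →L[ℂ] H)) ⊆ (M : Set (H →L[ℂ] H))) {σ : Weight D} {ρ : Weight M}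
    (hρσ : ∀ x ∈ posCone D, ρ.extend x = σ.extend x) (h : ExistsUniqueExtension ρ Φ) :
    ρ.ExtendsComp σ Φ := by
  have hPP := posCone_mono hDM
  obtain ⟨Ψ, ⟨hΨ, hpres, hext⟩, -⟩ := h
  constructor
  · intro a x y hx hy
    have h1 := hext a ⟨x, x.2.1⟩ hx
    have h2 := hpres x ⟨y, hPP y.2⟩ (by rw [h1]; exact hy)
    rw [← h2, ← ρ.extend_of_mem, hρσ _ y.2, σ.extend_coe]
  · intro a z w hz hw
    -- `Ψ` maps a decomposition of `a` to one of `Φ a` with the same weights.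
    refine Weight.HasValue.unique σ _ z w ?_ hw
    obtain ⟨p, hp, hpa, rfl⟩ := hz
    have hq : ∀ k, (Ψ ⟨p k, (p k).2.1⟩ : H →L[ℂ] H) ∈ posCone D := fun k =>
      ⟨(Ψ _).2, hΨ.nonneg _ (p k).2.2⟩
    have hval : ∀ k, σ ⟨_, hq k⟩ = ρ (p k) := fun k => by
      rw [← hpres (p k) ⟨_, hPP (hq k)⟩ rfl, ← ρ.extend_of_mem, hρσ _ (hq k), σ.extend_of_mem (hq k)]
    refine ⟨fun k => ⟨_, hq k⟩, fun k => by rw [hval]; exact hp k, ?_, ?_⟩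
    · rw [← hext a ⟨a, hAM a.2⟩ rfl]
      have : (⟨a, hAM a.2⟩ : M.toStarSubalgebra)
          = ∑ k : Fin 4, Complex.I ^ (k : ℕ) • (⟨p k, (p k).2.1⟩ : M.toStarSubalgebra) := by
        apply Subtype.ext
        simp only [hpa]
        simp
      rw [this]
      simp only [map_sum, map_smul]
      simp
    · exact Finset.sum_congr rfl fun k _ => by rw [hval]

end

/-! ### The Hoffman–Rossi construction and the maximal weight. -/

section

variable {M D : VonNeumannAlgebra H}
variable {A : Subalgebra ℂ (H →L[ℂ] H)} {Φ : A →ₐ[ℂ] D.toStarSubalgebra}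

/-- Interleaving of two square summable sequences. -/
theorem exists_interleave (ξ η : lp (fun _ : ℕ => H) 2) :
    ∃ ζ : lp (fun _ : ℕ => H) 2, (∀ k, ζ (2 * k) = ξ k) ∧ ∀ k, ζ (2 * k + 1) = η k := by
  let f : ℕ → H := fun n => if Even n then ξ (n / 2) else η (n / 2)
  have h0 : ∀ k, f (2 * k) = ξ k := fun k => by simp [f]
  have h1 : ∀ k, f (2 * k + 1) = η k := fun k => by
    have : (2 * k + 1) / 2 = k := by omega
    simp [f, this]
  have hf : Memℓp f 2 := by
    refine memℓp_gen ?_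
    have hξ := (lp.memℓp ξ).summable (by norm_num)
    have hη := (lp.memℓp η).summable (by norm_num)
    refine (HasSum.even_add_odd (f := fun n => ‖f n‖ ^ (2 : ℝ≥0∞).toReal)
      (m := ∑' k, ‖ξ k‖ ^ (2 : ℝ≥0∞).toReal) (m' := ∑' k, ‖η k‖ ^ (2 : ℝ≥0∞).toReal)
      ?_ ?_).summable
    · simp only [h0]; exact hξ.hasSum
    · simp only [h1]; exact hη.hasSum
  exact ⟨⟨f, hf⟩, h0, h1⟩

/-- The sum of two copies of `ℓ²(ℕ, H)` is a copy of `ℓ²(ℕ, H)`, so these functionals form a vector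
space. -/
theorem exists_normalForm_add (ξ₁ η₁ ξ₂ η₂ : lp (fun _ : ℕ => H) 2) :
    ∃ ξ η, normalForm ξ η = normalForm ξ₁ η₁ + normalForm ξ₂ η₂ := by
  obtain ⟨ξ, hξ₁, hξ₂⟩ := exists_interleave ξ₁ ξ₂
  obtain ⟨η, hη₁, hη₂⟩ := exists_interleave η₁ η₂
  refine ⟨ξ, η, LinearMap.ext fun x => ?_⟩
  rw [LinearMap.add_apply, normalForm_eq_tsum]
  refine (HasSum.even_add_odd ?_ ?_).tsum_eq
  · simp only [hξ₁, hη₁]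
    exact lp.hasSum_inner (𝕜 := ℂ) ξ₁ (amp x η₁)
  · simp only [hξ₂, hη₂]
    exact lp.hasSum_inner (𝕜 := ℂ) ξ₂ (amp x η₂)

/-- Weak* continuous functionals on a subspace of operators. -/
theorem exists_normalForm_of_continuous (A : Submodule ℂ (H →L[ℂ] H)) (g : A →ₗ[ℂ] ℂ)
    (hg : Continuous[weakStarTopologyOn (A : Set (H →L[ℂ] H)), inferInstance] g) :
    ∃ ξ η, ∀ a : A, g a = normalForm ξ η (a : H →L[ℂ] H) := by
  let f : lp (fun _ : ℕ => H) 2 × lp (fun _ : ℕ => H) 2 → A →ₗ[ℂ] ℂ := fun p =>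
    (normalForm p.1 p.2).comp A.subtype
  have htop : weakStarTopologyOn (A : Set (H →L[ℂ] H))
      = ⨅ p, TopologicalSpace.induced (f p) inferInstance := by
    rw [weakStarTopologyOn, weakStarTopology, iInf_prod]
    simp only [induced_iInf, induced_compose]
    rfl
  -- A functional continuous for the topology induced by a family of functionals is a combination of
  -- finitely many of them.
  have hmem : g ∈ Submodule.span ℂ (Set.range f) :=
    (LinearMap.mem_span_iff_continuous g).2 (htop ▸ hg)
  have key : ∃ ξ η, g = (normalForm ξ η).comp A.subtype := by
    refine Submodule.span_induction ?_ ?_ ?_ ?_ hmem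
    · rintro _ ⟨p, rfl⟩
      exact ⟨p.1, p.2, rfl⟩
    · refine ⟨0, 0, LinearMap.ext fun a => ?_⟩
      simp [normalForm_apply]
    · rintro _ _ - - ⟨ξ₁, η₁, rfl⟩ ⟨ξ₂, η₂, rfl⟩
      obtain ⟨ξ, η, h⟩ := exists_normalForm_add ξ₁ η₁ ξ₂ η₂
      exact ⟨ξ, η, by rw [h]; rfl⟩
    · rintro c _ - ⟨ξ, η, rfl⟩
      refine ⟨ξ, c • η, LinearMap.ext fun a => ?_⟩
      simp [normalForm_apply]
  obtain ⟨ξ, η, h⟩ := key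
  exact ⟨ξ, η, fun a => by rw [h]; rfl⟩

/-- The Hoffman–Rossi construction: a finite normal functional `ω` on `D` gives a vector functional
that vanishes on the kernel of `Φ` and whose null elements in `D` are null for `ω`. -/
theorem exists_vanishing_vector (hD : ∀ x ∈ D, ∀ y ∈ D, x * y = y * x)
    (hDA : (D : Set (H →L[ℂ] H)) ⊆ (A : Set (H →L[ℂ] H))) (hΦ : IsDCharacter Φ)
    (hΦc : Continuous[weakStarTopologyOn (A : Set (H →L[ℂ] H)),
      weakStarTopologyOn (D : Set (H →L[ℂ] H))] Φ)
    {ω : (H →L[ℂ] H) → ℝ≥0∞} (hω : NormalOn D ω) (hω1 : ω 1 ≠ ∞) :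
    ∃ ζ : lp (fun _ : ℕ => H) 2,
      (∀ a : A, Φ a = 0 → normalForm ζ ζ (a : H →L[ℂ] H) = 0) ∧
      ∀ p ∈ posCone D, normalForm ζ ζ p = 0 → ω p = 0 := by
  obtain ⟨ζ₀, hζ₀⟩ := exists_normalForm hD hω hω1
  -- The functional `ω ∘ Φ` on `A` as `a ↦ ⟪ξ, a η⟫`; here `ξ` and `η` may differ.
  obtain ⟨ξ, η, hg⟩ := exists_normalForm_of_continuous (Subalgebra.toSubmodule A)
    (((normalForm ζ₀ ζ₀).comp D.toStarSubalgebra.toSubalgebra.toSubmodule.subtype).comp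
      Φ.toLinearMap) (by
        let _ := weakStarTopology H
        let _ : TopologicalSpace D.toStarSubalgebra := weakStarTopologyOn (D : Set (H →L[ℂ] H))
        let _ : TopologicalSpace A := weakStarTopologyOn (A : Set (H →L[ℂ] H))
        exact ((continuous_normalForm ζ₀ ζ₀).comp continuous_induced_dom).comp hΦc)
  let V₀ : Submodule ℂ (lp (fun _ : ℕ => H) 2) :=
    (LinearMap.ker Φ.toLinearMap).map
      ({ toFun := fun a : A => amp (a : H →L[ℂ] H) η
         map_add' := fun a b => amp_add _ _ _
         map_smul' := fun c a => amp_smul _ _ _ } : A →ₗ[ℂ] lp (fun _ : ℕ => H) 2)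
  have hV₀ : ∀ a : A, Φ a = 0 → amp (a : H →L[ℂ] H) η ∈ V₀ := fun a ha => ⟨a, ha, rfl⟩
  have hinv : ∀ b : A, ∀ v ∈ V₀.topologicalClosure,
      amp (b : H →L[ℂ] H) v ∈ V₀.topologicalClosure := by
    intro b v hv
    refine map_mem_closure (amp (b : H →L[ℂ] H)).continuous hv ?_
    rintro _ ⟨a, ha, rfl⟩
    have : Φ (b * a) = 0 := by rw [map_mul, show Φ a = 0 from ha, mul_zero]
    exact ⟨b * a, this, amp_mul _ _ _⟩
  -- `ζ = η - v` is orthogonal to the closure of `(ker Φ) η`. For `a ∈ ker Φ` both `a η` and `a v`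
  -- lie in this closure, so `a ζ ⊥ ζ`.
  obtain ⟨v, hv, ζ, hζ, hsum⟩ := V₀.topologicalClosure.exists_add_mem_mem_orthogonal η
  refine ⟨ζ, fun a ha => ?_, fun p hp h0 => ?_⟩
  · have h1 : amp (a : H →L[ℂ] H) ζ ∈ V₀.topologicalClosure := by
      have h2 : amp (a : H →L[ℂ] H) ζ = amp (a : H →L[ℂ] H) η - amp (a : H →L[ℂ] H) v := by
        rw [hsum, map_add, add_sub_cancel_left]
      rw [h2]
      exact sub_mem (V₀.le_topologicalClosure (hV₀ a ha)) (hinv a v hv)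
    rw [normalForm_apply]
    exact (Submodule.mem_orthogonal' _ _).1 hζ _ h1
  · obtain ⟨r, hr, rfl⟩ := exists_sqrt_mem hp
    have h1 : amp r ζ = 0 := by
      rw [normalForm_mul_left, (posCone.isSelfAdjoint hr).star_eq, normalForm_apply,
        inner_self_eq_zero] at h0
      exact h0
    -- If `p = r²` kills `ζ`, then `p η = p v` lies in the closure, which is orthogonal to `ξ`
    -- because `ω ∘ Φ` vanishes on `ker Φ`.
    have h2 : amp (r * r) η ∈ V₀.topologicalClosure := by
      rw [hsum, map_add, amp_mul r r ζ, h1, _root_.map_zero, add_zero]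
      exact hinv ⟨r * r, hDA hp.1⟩ v hv
    have h3 : ∀ u ∈ V₀.topologicalClosure, ⟪ξ, u⟫_ℂ = 0 := by
      intro u hu
      have hclosed : IsClosed {u : lp (fun _ : ℕ => H) 2 | ⟪ξ, u⟫_ℂ = 0} :=
        isClosed_eq (continuous_const.inner continuous_id) continuous_const
      refine closure_minimal ?_ hclosed hu
      rintro _ ⟨a, ha, rfl⟩
      have h4 := hg a
      rw [LinearMap.comp_apply, show Φ.toLinearMap a = 0 from ha, _root_.map_zero] at h4
      exact h4.symm
    have h5 := hg ⟨r * r, hDA hp.1⟩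
    rw [normalForm_apply, h3 _ h2] at h5
    have h6 : normalForm ζ₀ ζ₀ (Φ ⟨r * r, hDA hp.1⟩ : H →L[ℂ] H) = 0 := h5
    rw [hΦ.map_of_mem ⟨r * r, hDA hp.1⟩ hp.1, hζ₀ _ hp] at h6
    have h7 : (ω (r * r)).toReal = 0 := by exact_mod_cast h6
    exact ((ENNReal.toReal_eq_zero_iff _).1 h7).resolve_right (hω.ne_top hω1 hp)

/-- If a linear functional is real on the positive parts and vanishes on their combination, then
the parts cancel. -/
theorem eq_of_sum_eq_zero {t : Fin 4 → ℝ≥0∞} (ht : ∀ k, t k ≠ ∞)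
    (h : ∑ k : Fin 4, Complex.I ^ (k : ℕ) * ((t k).toReal : ℂ) = 0) : t 0 = t 2 ∧ t 1 = t 3 := by
  rw [Fin.sum_univ_four] at h
  simp only [Fin.val_zero, Fin.val_one, Fin.val_two, pow_zero, pow_one, Complex.I_sq, one_mul,
    neg_mul, show ((3 : Fin 4) : ℕ) = 3 from rfl, Complex.I_pow_three] at h
  have hre := congrArg Complex.re h
  have him := congrArg Complex.im h
  simp at hre him
  exact ⟨(ENNReal.toReal_eq_toReal_iff' (ht 0) (ht 2)).1 (by linarith),
    (ENNReal.toReal_eq_toReal_iff' (ht 1) (ht 3)).1 (by linarith)⟩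

/-- The weight `ρ` annihilates the kernel of `Φ`. -/
def Annihilates (M : VonNeumannAlgebra H) (σ ρ : (H →L[ℂ] H) → ℝ≥0∞)
    (Φ : A →ₐ[ℂ] D.toStarSubalgebra) : Prop :=
  ∀ a : A, Φ a = 0 → ∀ d ∈ posCone D, σ d ≠ ∞ → ∀ p : Fin 4 → H →L[ℂ] H,
    (∀ k, p k ∈ posCone M) → (a : H →L[ℂ] H) = ∑ k : Fin 4, Complex.I ^ (k : ℕ) • p k →
      ρ (d * p 0) = ρ (d * p 2) ∧ ρ (d * p 1) = ρ (d * p 3)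

/-- With `τ = ⟪ζ, · ζ⟫` from `exists_vanishing_vector`, the larger weight is `ρ + ε τ (y ·)`. The
scale `ε` keeps it below `σ` at `d`, and the Hahn cut `y` makes this hold on all of `D`. -/
theorem exists_larger (hM : ∀ x ∈ M, ∀ y ∈ M, x * y = y * x)
    (hDA : (D : Set (H →L[ℂ] H)) ⊆ (A : Set (H →L[ℂ] H)))
    (hAM : (A : Set (H →L[ℂ] H)) ⊆ (M : Set (H →L[ℂ] H))) (hΦ : IsDCharacter Φ)
    (hΦc : Continuous[weakStarTopologyOn (A : Set (H →L[ℂ] H)),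
      weakStarTopologyOn (D : Set (H →L[ℂ] H))] Φ)
    {σ ρ : (H →L[ℂ] H) → ℝ≥0∞} (hσ : NormalOn D σ) (hf : ∀ x ∈ posCone D, σ x = 0 → x = 0)
    (hρ : NormalOn M ρ) (hle : ∀ x ∈ posCone D, ρ x ≤ σ x) (hann : Annihilates M σ ρ Φ)
    {d : H →L[ℂ] H} (hd : d ∈ posCone D) (hd1 : d ≤ 1) (hdfin : σ d ≠ ∞) (hlt : ρ d < σ d) :
    ∃ ρ' : (H →L[ℂ] H) → ℝ≥0∞, NormalOn M ρ' ∧ (∀ x ∈ posCone D, ρ' x ≤ σ x) ∧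
      Annihilates M σ ρ' Φ ∧ ρ ≤ ρ' ∧ ¬ ρ' ≤ ρ := by
  have hDM := hDA.trans hAM
  have hPP := posCone_mono hDM
  have hD : ∀ x ∈ D, ∀ y ∈ D, x * y = y * x := fun x hx y hy => hM x (hDM hx) y (hDM hy)
  obtain ⟨ζ, hζA, hζD⟩ := exists_vanishing_vector hD hDA hΦ hΦc (hσ.mul_left hD hd)
    (by simpa using hdfin)
  let τ : (H →L[ℂ] H) → ℝ≥0∞ := fun x => ∑' n, vecWeight (ζ n) x
  have hτ : ∀ N : VonNeumannAlgebra H, NormalOn N τ := fun N =>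
    NormalOn.tsum fun n => normalOn_vecWeight N (ζ n)
  have hτfin : ∀ x ∈ posCone M, τ x ≠ ∞ := fun x hx =>
    (hτ M).ne_top (tsum_vecWeight_ne_top ζ) hx
  have hτform : ∀ x ∈ posCone M, normalForm ζ ζ x = ((τ x).toReal : ℂ) := fun x hx =>
    normalForm_self_of_nonneg ζ hx.2
  obtain ⟨ε, hε0, hε⟩ : ∃ ε : ℝ≥0, 0 < ε ∧ ρ d + ε * τ d < σ d := by
    have hpos : 0 < σ d - ρ d := tsub_pos_of_lt hlt
    obtain ⟨δ, hδ0, hδ⟩ := ENNReal.exists_nnreal_pos_mul_lt (hτfin d (hPP hd)) hpos.ne'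
    refine ⟨δ, hδ0, ?_⟩
    calc ρ d + δ * τ d < ρ d + (σ d - ρ d) := ENNReal.add_lt_add_left hlt.ne_top hδ
      _ = σ d := add_tsub_cancel_of_le hlt.le
  obtain ⟨y, hy, hyd, hylt, hbelow⟩ := exists_le_below
    ((hρ.of_subset hDM).add_weight ((hτ D).const_mul ε)) hσ hd hε
  have hy1 := hyd.trans hd1
  have hy' := posCone.sub_mem posCone.one_mem hy hy1
  have hρ' : NormalOn M fun x => ρ x + ε * τ (y * x) :=
    hρ.add_weight (((hτ M).mul_left hM (hPP hy)).const_mul ε)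
  refine ⟨fun x => ρ x + ε * τ (y * x), hρ', fun x hx => ?_, ?_, fun x => le_self_add, fun hcon => ?_⟩
  · refine (hρ'.of_subset hDM).le_of_le_one hσ (fun z hz hz1 => ?_) hx
    have hyz := posCone.mul_mem hD hy hz
    have hy'z := posCone.mul_mem hD hy' hz
    have hyzy : y * z ≤ y := by
      rw [hD y hy.1 z hz.1]
      exact mul_le_of_le_one hD hy hz hz1
    have e2 : z = (1 - y) * z + y * z := by noncomm_ring
    have e3 : σ z = σ ((1 - y) * z) + σ (y * z) := by rw [← hσ.add _ hy'z _ hyz, ← e2]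
    have e4 : ρ z = ρ ((1 - y) * z) + ρ (y * z) := by
      rw [← hρ.add _ (hPP hy'z) _ (hPP hyz), ← e2]
    change ρ z + ε * τ (y * z) ≤ σ z
    rw [e3, e4, add_assoc]
    exact add_le_add (hle _ hy'z) (hbelow _ hyz hyzy)
  · intro a ha e he hefin p hp hpa
    obtain ⟨h1, h2⟩ := hann a ha e he hefin p hp hpa
    have hmem : ∀ k, y * (e * p k) ∈ posCone M := fun k =>
      posCone.mul_mem hM (hPP hy) (posCone.mul_mem hM (hPP he) (hp k))
    have hye : y * e ∈ D := mul_mem hy.1 he.1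
    obtain ⟨b, hb⟩ : ∃ b : A, (b : H →L[ℂ] H) = y * e := ⟨⟨y * e, hDA hye⟩, rfl⟩
    -- `y e a` is again in `ker Φ`, on which the functional of `ζ` vanishes.
    have h3 : normalForm ζ ζ (y * e * (a : H →L[ℂ] H)) = 0 := by
      have hba : Φ (b * a) = 0 := by rw [map_mul, ha, mul_zero]
      have h := hζA (b * a) hba
      rwa [Subalgebra.coe_mul, hb] at h
    have h4 : ∑ k : Fin 4, Complex.I ^ (k : ℕ) * ((τ (y * (e * p k))).toReal : ℂ) = 0 := by
      rw [← h3, hpa, Finset.mul_sum]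
      simp only [map_sum, mul_smul_comm, map_smul, smul_eq_mul]
      refine Finset.sum_congr rfl fun k _ => ?_
      rw [mul_assoc, hτform _ (hmem k)]
    obtain ⟨h5, h6⟩ := eq_of_sum_eq_zero (t := fun k => τ (y * (e * p k)))
      (fun k => hτfin _ (hmem k)) h4
    exact ⟨congrArg₂ (fun s t : ℝ≥0∞ => s + (ε : ℝ≥0∞) * t) h1 h5,
      congrArg₂ (fun s t : ℝ≥0∞ => s + (ε : ℝ≥0∞) * t) h2 h6⟩
  -- Without growth at `y`, `τ (y²) = 0`, hence `σ (d y²) = 0` and `d y² = 0` by faithfulness. Then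
  -- `y³ ≤ d y² = 0`, so `y = 0`, contrary to the strict inequality at `y`.
  · have hyy := posCone.mul_mem hD hy hy
    have hρy : ρ y ≠ ∞ :=
      ne_top_of_le_ne_top hdfin ((hle y hy).trans (hσ.mono hy hd hyd))
    have h1 : ρ y + ε * τ (y * y) ≤ ρ y + 0 := by simpa using hcon y
    have h2 : (ε : ℝ≥0∞) * τ (y * y) = 0 :=
      le_antisymm (ENNReal.le_of_add_le_add_left hρy h1) zero_le
    have h3 : τ (y * y) = 0 := (mul_eq_zero.1 h2).resolve_left (by exact_mod_cast hε0.ne')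
    have h4 : σ (d * (y * y)) = 0 := hζD _ hyy (by rw [hτform _ (hPP hyy), h3]; simp)
    have h5 : d * (y * y) = 0 := hf _ (posCone.mul_mem hD hd hyy) h4
    have h6 : y * y * y ≤ 0 := by
      rw [← h5, hD d hd.1 _ hyy.1]
      exact mul_le_mul_of_le hD hy hd hyy hyd
    have h7 : y * y * y = 0 := le_antisymm h6 (posCone.mul_mem hD hyy hy).2
    have hys := (posCone.isSelfAdjoint hy).star_eq
    have h8 : star (y * y) * (y * y) = 0 := by
      rw [star_mul, hys, ← mul_assoc, h7, zero_mul]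
    have h9 : star y * y = 0 := by
      rw [hys]
      exact (CStarRing.star_mul_self_eq_zero_iff _).1 h8
    have h10 : y = 0 := (CStarRing.star_mul_self_eq_zero_iff _).1 h9
    rw [h10, hρ.map_zero, hσ.map_zero] at hylt
    exact not_lt_zero hylt

/-- There is a normal weight on `M` that restricts to `σ` and annihilates the kernel of `Φ`. -/
theorem exists_normalOn_annihilates (hM : ∀ x ∈ M, ∀ y ∈ M, x * y = y * x)
    (hDA : (D : Set (H →L[ℂ] H)) ⊆ (A : Set (H →L[ℂ] H)))
    (hAM : (A : Set (H →L[ℂ] H)) ⊆ (M : Set (H →L[ℂ] H))) (hΦ : IsDCharacter Φ)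
    (hΦc : Continuous[weakStarTopologyOn (A : Set (H →L[ℂ] H)),
      weakStarTopologyOn (D : Set (H →L[ℂ] H))] Φ)
    {σ : (H →L[ℂ] H) → ℝ≥0∞} (hσ : NormalOn D σ) (hf : ∀ x ∈ posCone D, σ x = 0 → x = 0)
    (hs : ∀ k ∈ D, (∀ d ∈ posCone D, σ d ≠ ∞ → d * k = 0) → k = 0) :
    ∃ ρ : (H →L[ℂ] H) → ℝ≥0∞, NormalOn M ρ ∧ (∀ x ∈ posCone D, ρ x = σ x) ∧
      Annihilates M σ ρ Φ := by
  have hDM := hDA.trans hAM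
  have hPP := posCone_mono hDM
  have hD : ∀ x ∈ D, ∀ y ∈ D, x * y = y * x := fun x hx y hy => hM x (hDM hx) y (hDM hy)
  let 𝓟 : Set ((H →L[ℂ] H) → ℝ≥0∞) := {ρ | NormalOn M ρ ∧ (∀ x ∈ posCone D, ρ x ≤ σ x) ∧
    Annihilates M σ ρ Φ}
  obtain ⟨ρ, -, hmax⟩ := zorn_le_nonempty₀ 𝓟 (fun C hC hchain c hc => by
    have : Nonempty C := ⟨⟨c, hc⟩⟩
    refine ⟨fun x => ⨆ i : C, i.1 x, ⟨?_, fun x hx => iSup_le fun i => (hC i.2).2.1 x hx, ?_⟩,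
      fun i hi x => le_iSup (fun i : C => i.1 x) ⟨i, hi⟩⟩
    · refine NormalOn.iSup_comm_of_directed (fun i => (hC i.2).1) fun i j => ?_
      obtain ⟨k, hk, h1, h2⟩ := hchain.directedOn i i.2 j j.2
      exact ⟨⟨k, hk⟩, h1, h2⟩
    · intro a ha d hd hdfin p hp hpa
      exact ⟨iSup_congr fun i => ((hC i.2).2.2 a ha d hd hdfin p hp hpa).1,
        iSup_congr fun i => ((hC i.2).2.2 a ha d hd hdfin p hp hpa).2⟩) (fun _ => 0)
    ⟨NormalOn.zero, fun _ _ => zero_le, fun _ _ _ _ _ _ _ _ => ⟨rfl, rfl⟩⟩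
  obtain ⟨hρ, hle, hann⟩ := hmax.prop
  have heq1 : ∀ d ∈ posCone D, d ≤ 1 → σ d ≠ ∞ → ρ d = σ d := by
    intro d hd hd1 hdfin
    by_contra hne
    obtain ⟨ρ', h1, h2, h3, h4, h5⟩ := exists_larger hM hDA hAM hΦ hΦc hσ hf hρ hle hann hd hd1
      hdfin (lt_of_le_of_ne (hle d hd) hne)
    exact h5 (hmax.le_of_ge ⟨h1, h2, h3⟩ h4)
  have heq : ∀ d ∈ posCone D, σ d ≠ ∞ → ρ d = σ d := by
    intro d hd hdfin
    obtain ⟨t, e, he, he1, ht, rfl⟩ := exists_smul_le_one hd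
    rw [hρ.smul t e (hPP he), hσ.smul t e he, heq1 e he he1 fun h => hdfin (by
      rw [hσ.smul t e he, h, ENNReal.mul_top (by exact_mod_cast ht.ne')])]
  refine ⟨ρ, hρ, fun x hx => ?_, hann⟩
  -- Equality passes from finite to arbitrary elements along the contractions of finite weight
  -- increasing to `1`.
  obtain ⟨W, hWD, hWfin, hWne, hWd, hW⟩ := isLUB_one_of_semifinite hD hσ hs
  have h1 := (hρ.mul_left hM (hPP hx)).sup W (hWD.trans hPP) hWne hWd 1 posCone.one_mem hW
  have h2 := (hσ.mul_left hD hx).sup W hWD hWne hWd 1 posCone.one_mem hW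
  rw [mul_one] at h1 h2
  rw [h1, h2]
  refine iSup_congr fun w => iSup_congr fun hw => ?_
  refine heq _ (posCone.mul_mem hD hx (hWD hw)) ?_
  rw [hD x hx.1 w (hWD hw).1]
  exact hσ.mul_ne_top hD (hWD hw) (hWfin w hw) hx

end

end HoffmanRossi

end

/-! ### Assembly of the two claims. -/

theorem corollary5 {H : Type*} [NormedAddCommGroup H] [InnerProductSpace ℂ H] [CompleteSpace H]
    (M D : VonNeumannAlgebra H) (A : Subalgebra ℂ (H →L[ℂ] H))
    (hM : ∀ x ∈ M, ∀ y ∈ M, x * y = y * x)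
    (hDA : (D : Set (H →L[ℂ] H)) ⊆ (A : Set (H →L[ℂ] H)))
    (hAM : (A : Set (H →L[ℂ] H)) ⊆ (M : Set (H →L[ℂ] H)))
    (hA : IsClosed[HoffmanRossi.weakStarTopology H] (A : Set (H →L[ℂ] H)))
    (σ : HoffmanRossi.Weight D)
    (hσf : σ.IsFaithful) (hσn : σ.IsNormal) (hσs : σ.IsSemifinite)
    (Φ : A →ₐ[ℂ] D.toStarSubalgebra) (hΦ : HoffmanRossi.IsDCharacter Φ)
    (hΦc : Continuous[HoffmanRossi.weakStarTopologyOn (A : Set (H →L[ℂ] H)),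
      HoffmanRossi.weakStarTopologyOn (D : Set (H →L[ℂ] H))] Φ) :
    (∃ ρ : HoffmanRossi.Weight M, ρ.IsNormal ∧ ρ.IsSemifinite ∧ ρ.ExtendsComp σ Φ ∧
      HoffmanRossi.ExistsUniqueExtension ρ Φ) ∧
    (∀ ρ : HoffmanRossi.Weight M, ρ.IsNormal → ρ.IsSemifinite → ρ.IsTracial →
      ρ.ExtendsComp σ Φ → HoffmanRossi.ExistsUniqueExtension ρ Φ) := by
  refine ⟨?_, fun ρ hρ _ _ hext =>
    HoffmanRossi.existsUniqueExtension_of_extendsComp hM hDA hAM hσf hσs hΦ hρ hext⟩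
  have hDM := hDA.trans hAM
  have hPP := HoffmanRossi.posCone_mono hDM
  have hf : ∀ x ∈ HoffmanRossi.posCone D, σ.extend x = 0 → x = 0 := fun x hx h0 => by
    rw [σ.extend_of_mem hx] at h0
    exact hσf _ h0
  obtain ⟨ρ, hρ, hρσ, hann⟩ := HoffmanRossi.exists_normalOn_annihilates hM hDA hAM hΦ hΦc
    hσn.normalOn hf fun k _ h => hσs.eq_zero h
  have hext : ∀ x ∈ HoffmanRossi.posCone M, hρ.toWeight.extend x = ρ x := fun x hx =>
    hρ.toWeight.extend_of_mem hx
  have hrestr : ∀ x ∈ HoffmanRossi.posCone D, hρ.toWeight.extend x = σ.extend x := fun x hx => by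
    rw [hext x (hPP hx), hρσ x hx]
  have hunique : HoffmanRossi.ExistsUniqueExtension hρ.toWeight Φ := by
    refine HoffmanRossi.existsUniqueExtension_of_represents hM hDM hρ.isNormal_toWeight
      (fun x hx h0 => hf x hx (by rwa [hrestr x hx] at h0))
      (fun k _ h => hσs.eq_zero fun d hd hdfin => h d hd (by rwa [hrestr d hd]))
      fun a d hd hdfin ζ hζ => ?_
    rw [hrestr d hd] at hdfin
    have hΦD : (Φ a : H →L[ℂ] H) ∈ D := (Φ a).2
    obtain ⟨p, hp, hpa⟩ := HoffmanRossi.exists_posCone_decomp (N := M)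
      (sub_mem (hAM a.2) (hDM hΦD))
    -- `a - Φ(a)` lies in `ker Φ`, as `Φ` is the identity on `D`; so `ρ (d ·)` takes the same value
    -- at `a` and `Φ a`.
    obtain ⟨h1, h2⟩ := hann (a - ⟨Φ a, hDA hΦD⟩) (by
      rw [map_sub, sub_eq_zero]
      exact Subtype.ext (hΦ.map_of_mem ⟨Φ a, hDA hΦD⟩ hΦD).symm) d hd hdfin p hp hpa
    have hval : ∀ k, HoffmanRossi.normalForm ζ ζ (p k) = ((ρ (d * p k)).toReal : ℂ) := fun k => by
      rw [hζ _ (hp k), hext _ (HoffmanRossi.posCone.mul_mem hM (hPP hd) (hp k))]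
    rw [← sub_eq_zero, ← map_sub, hpa, map_sum, Fin.sum_univ_four]
    simp only [map_smul, hval, h1, h2]
    simp [Complex.I_pow_three]
  exact ⟨hρ.toWeight, hρ.isNormal_toWeight,
    HoffmanRossi.isSemifinite_of_restrict hM hDM hσs hρ.isNormal_toWeight hrestr,
    HoffmanRossi.extendsComp_of_existsUniqueExtension hDM hAM hrestr hunique, hunique⟩
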